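/- A randomized streaming algorithm $\mathcal A$ processes inputs $X_1,X_2,\dots\in\mathbb Z_{\ge 0}$, where $X_i$ is the number of increments of a counter in the $i$th step. Its memory state $M_i$ after the $i$th input is a finite bit string of length $|M_i|$; the initial state $M_0$ may be random, and $M_i$ is a function (which may depend on $i$) of $M_{i-1}$, $X_i$ and fresh independent random bits. A query after step $i$ returns a random real number $\hat N$ that depends only on $i$, $M_i$ and fresh random bits. For $n\in\mathbb N$, $\mathcal A$ is an $(\epsilon,\delta)$-approximate counter for counts up to $n$ if for every fixed finite input sequence with sum $N$, $1\le N\le n$, a query after that sequence satisfies $\mathbb P(|\hat N-N|\ge\epsilon N)\le\delta$. (An $(\epsilon,\delta)$-approximate counter, which satisfies this for all $N\ge1$, is in particular one for counts up to $n$.) For a distribution $\mathcal D$ on $\mathbb Z_{\ge0}^n$ and $(X_1,\dots,X_n)\sim\mathcal D$, the (Braverman–Garg–Woodruff) information cost of $\mathcal A$ is $$\mathrm{IC}(\mathcal A;\mathcal D)=\sum_{i=1}^n\sum_{j=1}^i I(M_i;X_j\mid M_{j-1}),$$ where $I(\cdot\,;\cdot\mid\cdot)$ is conditional mutual information. For integers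 $B\ge2$ and $L\ge1$ put $T=B^L$ and $n=TL$, and let $\mathcal D_{B,L}$ be the law of the interleaved sequence $$(X_1,\dots,X_n)=(Y_{1,1},\dots,Y_{L,1},\,Y_{1,2},\dots,Y_{L,2},\,\dots,\,Y_{1,T},\dots,Y_{L,T}),$$ where the $Y_{\ell,i}$ ($1\le\ell\le L$, $1\le i\le T$) are independent, $Y_{\ell,i}$ is uniform on $\{0,B^\ell\}$ if $B^\ell$ divides $i-1$, and $Y_{\ell,i}=0$ otherwise. **Lemma.** There are an integer $B\ge2$ and constants $c_1,\dots,c_7>0$ such that the following holds for every $\delta\in(0,c_1)$. Let $L$ be the largest integer $k\ge0$ with $B^k<\log_{32}(1/\delta)$, and let $T=B^L$, $n=TL$ and $\mathcal D=\mathcal D_{B,L}$. Then $L\ge1$, $n\ge c_3\log^{c_4}(1/\delta)$, $\mathbb P_{X\sim\mathcal D}\big[\sum_{i=1}^nX_i\le n\big]=1$, and $c_7\log\log(1/\delta)\le\min\{\log n,\log\log(1/\delta)\}$. Moreover, for every $\epsilon\in\big(0,\tfrac{c_2}{\log\log(1/\delta)}\big)$ and every $(\epsilon,\delta)$-approximate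 counter $\mathcal A$ for counts up to $n$, $$\mathrm{IC}(\mathcal A;\mathcal D)\ge c_5\,n\log\log(1/\delta),$$ and, for inputs drawn from $\mathcal D$, $$\frac1n\sum_{i=1}^n\mathbb E|M_i|\ \ge\ c_6\log\log(1/\delta)\ \ge\ c_6\min\{\log n,\log\log(1/\delta)\}.$$ -/

import Mathlib

open MeasureTheory ProbabilityTheory
open scoped ENNReal

noncomputable section

namespace ApproxCounting

/-- A memory state is a finite bit string; the space it uses is its length. -/
abbrev Mem : Type := List Bool

instance : MeasurableSpace Mem := ⊤

instance : DiscreteMeasurableSpace Mem := ⟨fun _ => trivial⟩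

/-- A randomized streaming algorithm whose inputs are natural numbers, the input `a` standing
for `a` increments of the counter.  The initial state may be random; a state, an input and fresh
random bits determine the next state, so the law of the next state depends on the current state
and the input only.  The position in the stream (here `t` is the number of inputs processed
so far) is available to the algorithm for free. A query in state `m` returns a (possibly
randomized) real number. -/
structure StreamingAlgorithm where
  init : PMF Mem
  step : (t : ℕ) → Mem → ℕ → PMF Mem
  query : (t : ℕ) → Mem → ProbabilityMeasure ℝ

namespace StreamingAlgorithm

/-- The law of the sequence of memory states `(M₀, M₁, …, M_s)` on the fixed input sequence
`x = (x₁, …, x_s)` (the input `x_{i+1}` is `x i`). -/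
def trajectory (A : StreamingAlgorithm) : (s : ℕ) → (Fin s → ℕ) → PMF (Fin (s + 1) → Mem)
  | 0, _ => A.init.map fun m _ => m
  | s + 1, x =>
      (A.trajectory s (Fin.init x)).bind fun M =>
        (A.step s (M (Fin.last s)) (x (Fin.last s))).map fun m =>
          (Fin.snoc M m : Fin (s + 2) → Mem)

/-- The probability that a query, made after the input sequence `x` with sum `N`, returns a
value `N'` with `|N' - N| ≥ ε N`. -/
def failureProb (A : StreamingAlgorithm) (ε : ℝ) {s : ℕ} (x : Fin s → ℕ) : ℝ≥0∞ :=
  ∫⁻ M, (A.query s (M (Fin.last s)) : Measure ℝ)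
      {y : ℝ | ε * ((∑ i, x i : ℕ) : ℝ) ≤ |y - ((∑ i, x i : ℕ) : ℝ)|}
    ∂(A.trajectory s x).toMeasure

/-- `A` is an `(ε, δ)`-approximate counter for counts up to `n`: at every moment at which the
count `N` satisfies `1 ≤ N ≤ n`, a query returns a value `N'` with
`P(|N' - N| ≥ ε N) ≤ δ`.  (For `N = 0` the event `|N' - N| ≥ ε N` always occurs.) -/
def IsApproxCounterUpTo (A : StreamingAlgorithm) (ε δ : ℝ) (n : ℕ) : Prop :=
  ∀ (s : ℕ) (x : Fin s → ℕ), 1 ≤ ∑ i, x i → ∑ i, x i ≤ n →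
    A.failureProb ε x ≤ ENNReal.ofReal δ

/-- The joint law of the inputs `(X₁, …, X_s) ∼ D` and the memory states `(M₀, …, M_s)`. -/
def jointLaw (A : StreamingAlgorithm) {s : ℕ} (D : PMF (Fin s → ℕ)) :
    Measure ((Fin s → ℕ) × (Fin (s + 1) → Mem)) :=
  (D.bind fun x => (A.trajectory s x).map fun M => (x, M)).toMeasure

end StreamingAlgorithm

/-- The conditional mutual information `I(X ; Y | Z)` (in nats) for a discrete random variable
`Z`, as the average over the values `z` of `Z` of the Kullback-Leibler divergence between the
conditional law of `(X, Y)` given `Z = z` and the product of its marginals.  It equals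
`H(X | Z) - H(X | Y, Z)` when these entropies are finite. -/
def condMutualInfo {Ω α β γ : Type*} [MeasurableSpace Ω] [MeasurableSpace α] [MeasurableSpace β]
    (P : Measure Ω) (X : Ω → α) (Y : Ω → β) (Z : Ω → γ) : ℝ≥0∞ :=
  ∑' z, P (Z ⁻¹' {z}) *
    InformationTheory.klDiv
      ((ProbabilityTheory.cond P (Z ⁻¹' {z})).map fun ω => (X ω, Y ω))
      (((ProbabilityTheory.cond P (Z ⁻¹' {z})).map X).prod
        ((ProbabilityTheory.cond P (Z ⁻¹' {z})).map Y))

namespace StreamingAlgorithm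

/-- The information cost `∑_{i=1}^s ∑_{j=1}^i I(M_i ; X_j | M_{j-1})`. For `i j : Fin s`, which
count from `0`, `M_{i+1}`, `X_{j+1}` and `M_j` are `ω.2 i.succ`, `ω.1 j`, `ω.2 j.castSucc`. -/
def infoCost (A : StreamingAlgorithm) {s : ℕ} (D : PMF (Fin s → ℕ)) : ℝ≥0∞ :=
  ∑ i : Fin s, ∑ j ∈ Finset.Iic i,
    condMutualInfo (A.jointLaw D) (fun ω => ω.2 i.succ) (fun ω => ω.1 j)
      (fun ω => ω.2 j.castSucc)

/-- The average expected memory `(1/s) ∑_{i=1}^s E|M_i|`, in bits. -/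
def avgMemory (A : StreamingAlgorithm) {s : ℕ} (D : PMF (Fin s → ℕ)) : ℝ≥0∞ :=
  (∑ i : Fin s, ∫⁻ ω, ((ω.2 i.succ).length : ℝ≥0∞) ∂(A.jointLaw D)) / (s : ℝ≥0∞)

end StreamingAlgorithm

/-- The multi-scale interleaved distribution with base `B`, scales `ℓ = 1, …, L` and `T = B ^ L`:
the law of `(Y_{1,1}, …, Y_{L,1}, Y_{1,2}, …, Y_{L,2}, …, Y_{1,T}, …, Y_{L,T})`, where the
`Y_{ℓ,i}` are independent, `Y_{ℓ,i}` is uniform on `{0, B ^ ℓ}` if `B ^ ℓ ∣ i - 1`, and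
`Y_{ℓ,i} = 0` otherwise.  The entry at position `k`, counted from `0`, is `Y_{ℓ,i}` with
`i - 1 = k / L` and `ℓ = k % L + 1`; the `b k` are independent fair bits. -/
def interleavedDist (B L : ℕ) : PMF (Fin (B ^ L * L) → ℕ) :=
  (PMF.uniformOfFintype (Fin (B ^ L * L) → Bool)).map fun b k =>
    if B ^ ((k : ℕ) % L + 1) ∣ (k : ℕ) / L ∧ b k = true then B ^ ((k : ℕ) % L + 1) else 0

end ApproxCounting

end

/-! ### Correlation events, mutual information and conditional entropy. -/

namespace ApproxCounting

/-! Fix a scale `D = B ^ (l + 1)` below the top one and choose disjoint windows of the stream, each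
opening with an entry of that scale and placed so that every other nonzero entry in it has a smaller
scale. Since `B` is large, these other entries have total variance far below `D ^ 2`, so the first
bit moves the count up or down by `D / 2` against little noise. Suppose that for most windows the
two end states leave both values of the first bit likely. Given the end states, the inside of a
window is independent of everything outside, in particular of the final state. So, at the price of a
factor `8⁻¹` per window, the first bits of all good windows may be required to be set, or all to be
unset, without touching the query. Relative to a common reference value `V` the count then moves by
at least `|Q| D / 8 ≥ ε N`, upwards or downwards at will; an answer below `V` is wrong in the first
case, an answer above it in the second. As this contradicts the smallness of `δ`, in a constant
average proportion the state after the window must be correlated with its first input, given the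
state before it (`le_sum_corrProb`).

This works for every window length up to the spacing `D L`. Summing over windows and lengths yields
order `n / B` for each of `L - 1` scales, and `L` has the order of `log log (1 / δ)`
(`le_sum_sum_corrProb`).

Correlation is recorded by the probability of an event (`corrSet`), because this one quantity bounds
both targets. It is at most 30 times the conditional mutual information
(`measure_corrSet_le_condMutualInfo`), which gives the information cost. It is also at most 30 times
an entropy drop along the Markov chain of states (`condEntropy_add_le`); these drops telescope to
`H(M_i | M_0)`, which a prefix-free-type code bounds by the expected length
(`condEntropy_le_length`). -/

theorem div_thirty_le_of_le {a b k : ℝ≥0∞} (ha : a ≠ ∞) (hab : 3 * b ≤ 2 * a)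
    (hk : a / 5 ≤ k + b / 4) : a / 30 ≤ k := by
  have hb : b ≠ ∞ := by
    rintro rfl
    rw [ENNReal.mul_top (by norm_num), top_le_iff] at hab
    exact ENNReal.mul_ne_top (by norm_num) ha hab
  by_cases hkt : k = ∞
  · simp [hkt]
  lift a to NNReal using ha
  lift b to NNReal using hb
  lift k to NNReal using hkt
  rw [show (30 : ℝ≥0∞) = ((30 : NNReal) : ℝ≥0∞) by norm_num, ← ENNReal.coe_div (by norm_num)]
  rw [show (5 : ℝ≥0∞) = ((5 : NNReal) : ℝ≥0∞) by norm_num,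
    show (4 : ℝ≥0∞) = ((4 : NNReal) : ℝ≥0∞) by norm_num, ← ENNReal.coe_div (by norm_num),
    ← ENNReal.coe_div (by norm_num)] at hk
  norm_cast at hk hab ⊢
  rw [← NNReal.coe_le_coe] at hk hab ⊢
  push_cast at hk hab ⊢
  linarith

-- Donsker–Varadhan with the test function `log (5/4)` on `S` and `0` elsewhere, weakened by `log
-- (5/4) ≥ 1/5`. Pointwise on `S` it is a tangent-line bound for `klFun`; off `S` nonnegativity of
-- `klFun` suffices.
open InformationTheory in
theorem measure_le_klDiv_add {α : Type*} [MeasurableSpace α] (μ ν : Measure α)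
    [IsFiniteMeasure μ] [IsFiniteMeasure ν] (S : Set α) :
    μ S / 5 ≤ klDiv μ ν + ν S / 4 := by
  rw [klDiv_eq_lintegral_klFun]
  split_ifs with hac
  swap
  · simp
  have key : ∀ x : ℝ, 0 ≤ x → x / 5 ≤ klFun x + 1 / 4 := by
    intro x hx
    rw [klFun_apply]
    rcases hx.eq_or_lt with rfl | hx
    · norm_num
    have h1 := Real.log_le_sub_one_of_pos (show (0 : ℝ) < 5 / 4 / x by positivity)
    have h2 := Real.log_le_sub_one_of_pos (show (0 : ℝ) < 4 / 5 by norm_num)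
    rw [Real.log_div (by norm_num) hx.ne'] at h1
    have h3 : Real.log (4 / 5) = - Real.log (5 / 4) := by
      rw [← Real.log_inv]; norm_num
    have h4 : Real.log x ≥ 6 / 5 - 5 / 4 / x := by linarith
    have h5 : x * Real.log x ≥ x * (6 / 5 - 5 / 4 / x) := by gcongr
    have h6 : x * (6 / 5 - 5 / 4 / x) = x * (6 / 5) - 5 / 4 := by field_simp
    linarith
  calc μ S / 5 = (∫⁻ x in S, μ.rnDeriv ν x ∂ν) / 5 := by
        rw [Measure.setLIntegral_rnDeriv hac]
    _ = ∫⁻ x in S, μ.rnDeriv ν x / 5 ∂ν := by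
        simp_rw [div_eq_mul_inv]
        rw [lintegral_mul_const _ (Measure.measurable_rnDeriv μ ν)]
    _ ≤ ∫⁻ x in S, (ENNReal.ofReal (klFun (μ.rnDeriv ν x).toReal) + 1 / 4) ∂ν := by
        refine lintegral_mono_ae (ae_restrict_of_ae ?_)
        filter_upwards [μ.rnDeriv_lt_top ν] with x hx
        have := ENNReal.ofReal_le_ofReal (key _ (ENNReal.toReal_nonneg (a := μ.rnDeriv ν x)))
        rw [ENNReal.ofReal_add (klFun_nonneg ENNReal.toReal_nonneg) (by norm_num),
          ENNReal.ofReal_div_of_pos (by norm_num), ENNReal.ofReal_toReal hx.ne,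
          ENNReal.ofReal_div_of_pos (by norm_num)] at this
        simpa using this
    _ = (∫⁻ x in S, ENNReal.ofReal (klFun (μ.rnDeriv ν x).toReal) ∂ν) + ν S / 4 := by
        rw [lintegral_add_right _ measurable_const]
        simp [div_eq_mul_inv, mul_comm]
    _ ≤ _ := by
        exact add_le_add_left (setLIntegral_le_lintegral _ _) _

section Discrete

variable {Ω α β γ κ : Type*} [MeasurableSpace Ω] [DiscreteMeasurableSpace Ω]

/-- The event that the conditional joint probability of the values of `X` and `Y` given `Z` exceeds
the product of their conditional probabilities by a factor of at least `3 / 2`. -/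
def corrSet (P : Measure Ω) (X : Ω → α) (Y : Ω → β) (Z : Ω → γ) : Set Ω :=
  {ω | 3 * (P {ω' | Z ω' = Z ω ∧ Y ω' = Y ω} * P {ω' | Z ω' = Z ω ∧ X ω' = X ω}) ≤
    2 * (P {ω' | Z ω' = Z ω ∧ Y ω' = Y ω ∧ X ω' = X ω} * P {ω' | Z ω' = Z ω})}

theorem corrSet_map {Ω' : Type*} [MeasurableSpace Ω'] [DiscreteMeasurableSpace Ω']
    (P : Measure Ω) (Φ : Ω → Ω') (X : Ω' → α) (Y : Ω' → β) (Z : Ω' → γ) :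
    Φ ⁻¹' corrSet (P.map Φ) X Y Z =
      corrSet P (fun ω => X (Φ ω)) (fun ω => Y (Φ ω)) (fun ω => Z (Φ ω)) := by
  ext ω
  simp only [corrSet, Set.mem_preimage, Set.mem_ofPred_eq]
  simp only [Measure.map_apply (Measurable.of_discrete (f := Φ)) (MeasurableSet.of_discrete),
    Set.preimage_ofPred_eq]

variable [Countable α] [Countable β] [Countable γ] [Countable κ]

theorem tsum_measure_inter_fiber (P : Measure Ω) (Z : Ω → γ) (S : Set Ω) :
    ∑' z, P (S ∩ Z ⁻¹' {z}) = P S := by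
  rw [← measure_iUnion]
  · congr 1
    ext ω
    simp
  · intro i j hij
    refine Set.disjoint_left.2 ?_
    rintro ω ⟨_, h1⟩ ⟨_, h2⟩
    exact hij (h1.symm.trans h2)
  · exact fun _ => MeasurableSet.of_discrete

-- On each fibre of `Z` the event is a set `T` of values on which the product law has at most `2/3`
-- of the joint mass. The divergence is then at least `1/5 - (1/4)(2/3) = 1/30` of the joint mass of
-- `T`.
open InformationTheory in
theorem measure_corrSet_le_condMutualInfo [MeasurableSpace α] [MeasurableSpace β]
    [DiscreteMeasurableSpace α] [DiscreteMeasurableSpace β]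
    (P : Measure Ω) [IsProbabilityMeasure P] (X : Ω → α) (Y : Ω → β) (Z : Ω → γ) :
    P (corrSet P X Y Z) / 30 ≤ condMutualInfo P X Y Z := by
  classical
  rw [condMutualInfo, ← tsum_measure_inter_fiber P Z, div_eq_mul_inv, ← ENNReal.tsum_mul_right]
  refine ENNReal.tsum_le_tsum fun z => ?_
  rw [← div_eq_mul_inv]
  set S := corrSet P X Y Z
  by_cases hz : P (Z ⁻¹' {z}) = 0
  · simp [measure_mono_null Set.inter_subset_right hz]
  have hzt : P (Z ⁻¹' {z}) ≠ ∞ := measure_ne_top _ _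
  set Q := ProbabilityTheory.cond P (Z ⁻¹' {z}) with hQ
  have : IsProbabilityMeasure Q := cond_isProbabilityMeasure hz
  have hQa : ∀ A : Set Ω, P (Z ⁻¹' {z}) * Q A = P (Z ⁻¹' {z} ∩ A) := fun A => by
    rw [hQ, cond_apply MeasurableSet.of_discrete, ← mul_assoc, ENNReal.mul_inv_cancel hz hzt,
      one_mul]
  set T : Set (α × β) := {t | 3 * (Q (Y ⁻¹' {t.2}) * Q (X ⁻¹' {t.1})) ≤
    2 * Q (Y ⁻¹' {t.2} ∩ X ⁻¹' {t.1})} with hT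
  have hST : S ∩ Z ⁻¹' {z} = Z ⁻¹' {z} ∩ (fun ω => (X ω, Y ω)) ⁻¹' T := by
    ext ω
    simp only [Set.mem_inter_iff, Set.mem_preimage, Set.mem_singleton_iff, hT, Set.mem_ofPred_eq]
    rw [and_comm]
    refine and_congr_right fun hω => ?_
    simp only [S, corrSet, Set.mem_ofPred_eq, hω]
    have e1 : {ω' | Z ω' = z ∧ Y ω' = Y ω} = Z ⁻¹' {z} ∩ (Y ⁻¹' {Y ω}) := rfl
    have e2 : {ω' | Z ω' = z ∧ X ω' = X ω} = Z ⁻¹' {z} ∩ (X ⁻¹' {X ω}) := rfl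
    have e3 : {ω' | Z ω' = z ∧ Y ω' = Y ω ∧ X ω' = X ω} =
      Z ⁻¹' {z} ∩ (Y ⁻¹' {Y ω} ∩ X ⁻¹' {X ω}) := rfl
    have e4 : {ω' | Z ω' = z} = Z ⁻¹' {z} := rfl
    rw [e1, e2, e3, e4, ← hQa, ← hQa, ← hQa]
    have h2 : ∀ a b c : ℝ≥0∞, 3 * (P (Z ⁻¹' {z}) * a * (P (Z ⁻¹' {z}) * b)) ≤
        2 * (P (Z ⁻¹' {z}) * c * P (Z ⁻¹' {z})) ↔ 3 * (a * b) ≤ 2 * c := by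
      intro a b c
      rw [show 3 * (P (Z ⁻¹' {z}) * a * (P (Z ⁻¹' {z}) * b)) =
        (P (Z ⁻¹' {z}) * P (Z ⁻¹' {z})) * (3 * (a * b)) by ring,
        show 2 * (P (Z ⁻¹' {z}) * c * P (Z ⁻¹' {z})) =
        (P (Z ⁻¹' {z}) * P (Z ⁻¹' {z})) * (2 * c) by ring]
      exact ENNReal.mul_le_mul_iff_right (mul_ne_zero hz hz) (ENNReal.mul_ne_top hzt hzt)
    exact h2 _ _ _
  have hμT : (Q.map fun ω => (X ω, Y ω)) T = Q ((fun ω => (X ω, Y ω)) ⁻¹' T) :=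
    Measure.map_apply Measurable.of_discrete MeasurableSet.of_discrete
  have : IsProbabilityMeasure (Q.map X) :=
    Measure.isProbabilityMeasure_map Measurable.of_discrete.aemeasurable
  have : IsProbabilityMeasure (Q.map Y) :=
    Measure.isProbabilityMeasure_map Measurable.of_discrete.aemeasurable
  have : IsProbabilityMeasure (Q.map fun ω => (X ω, Y ω)) :=
    Measure.isProbabilityMeasure_map Measurable.of_discrete.aemeasurable
  have hνT : 3 * ((Q.map X).prod (Q.map Y)) T ≤ 2 * (Q.map fun ω => (X ω, Y ω)) T := by
    rw [← lintegral_indicator_one (MeasurableSet.of_discrete (s := T)),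
      ← lintegral_indicator_one (MeasurableSet.of_discrete (s := T)),
      lintegral_countable', lintegral_countable', ← ENNReal.tsum_mul_left,
      ← ENNReal.tsum_mul_left]
    refine ENNReal.tsum_le_tsum fun t => ?_
    by_cases ht : t ∈ T
    · simp only [Set.indicator_of_mem ht, Pi.one_apply, one_mul]
      have e1 : ({t} : Set (α × β)) = {t.1} ×ˢ {t.2} := by simp
      rw [Measure.map_apply Measurable.of_discrete (MeasurableSet.of_discrete), e1,
        Measure.prod_prod, Measure.map_apply Measurable.of_discrete (MeasurableSet.of_discrete),
        Measure.map_apply Measurable.of_discrete (MeasurableSet.of_discrete),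
        mul_comm (Q (X ⁻¹' _))]
      have e2 : (fun ω => (X ω, Y ω)) ⁻¹' ({t.1} ×ˢ {t.2}) = Y ⁻¹' {t.2} ∩ X ⁻¹' {t.1} := by
        ext ω; simp [and_comm, Prod.ext_iff]
      rw [e2]
      exact ht
    · simp [Set.indicator_of_notMem ht]
  have hkl := measure_le_klDiv_add (Q.map fun ω => (X ω, Y ω)) ((Q.map X).prod (Q.map Y)) T
  have h30 : (Q.map fun ω => (X ω, Y ω)) T / 30 ≤
      klDiv (Q.map fun ω => (X ω, Y ω)) ((Q.map X).prod (Q.map Y)) := by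
    exact div_thirty_le_of_le (measure_ne_top _ _) hνT hkl
  rw [hST, ← hQa, ← hμT, mul_div_assoc]
  gcongr

/-- The conditional entropy `H(X | Z)`, in nats. -/
noncomputable def condEntropy (P : Measure Ω) (X : Ω → α) (Z : Ω → γ) : ℝ≥0∞ :=
  ∫⁻ ω, ENNReal.ofReal (-Real.log
    (P {ω' | Z ω' = Z ω ∧ X ω' = X ω} / P {ω' | Z ω' = Z ω}).toReal) ∂P

theorem tsum_measure_and_eq (P : Measure Ω) (W : Ω → κ) (p : Ω → Prop) :
    ∑' w, P {ω | p ω ∧ W ω = w} = P {ω | p ω} :=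
  tsum_measure_inter_fiber P W {ω | p ω}

theorem lintegral_comp_eq_tsum (P : Measure Ω) (φ : Ω → κ) (h : κ → ℝ≥0∞) :
    ∫⁻ ω, h (φ ω) ∂P = ∑' k, h k * P {ω | φ ω = k} := by
  let _ : MeasurableSpace κ := ⊤
  have : DiscreteMeasurableSpace κ := ⟨fun _ => trivial⟩
  rw [← lintegral_map (f := h) Measurable.of_discrete Measurable.of_discrete,
    lintegral_countable']
  refine tsum_congr fun k => ?_
  rw [Measure.map_apply Measurable.of_discrete MeasurableSet.of_discrete]
  rfl

/-- By `hM`, `X` is independent of `(Z, Y)` given `W`, so dividing by `P(X | W)` removes the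
dependence of `X` on `W`. Summing over `w` leaves `P(Z, Y) P(X | Z)`, as if `X` were redrawn given
`Z` alone. Only an inequality remains because atoms of probability zero are lost on the left. -/
theorem setLIntegral_likelihoodRatio_le (P : Measure Ω) [IsFiniteMeasure P]
    (X : Ω → α) (Y : Ω → β) (Z : Ω → γ) (W : Ω → κ)
    (hM : ∀ z y w x, P {ω | Z ω = z ∧ Y ω = y ∧ W ω = w ∧ X ω = x} * P {ω | W ω = w} =
      P {ω | Z ω = z ∧ Y ω = y ∧ W ω = w} * P {ω | W ω = w ∧ X ω = x})
    (T : Set (γ × β × α)) :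
    ∫⁻ ω in (fun ω => (Z ω, Y ω, X ω)) ⁻¹' T,
      P {ω' | Z ω' = Z ω ∧ X ω' = X ω} / P {ω' | Z ω' = Z ω} /
      (P {ω' | W ω' = W ω ∧ X ω' = X ω} / P {ω' | W ω' = W ω}) ∂P ≤
    ∑' t : γ × β × α, T.indicator (fun t => P {ω | Z ω = t.1 ∧ Y ω = t.2.1} *
      (P {ω | Z ω = t.1 ∧ X ω = t.2.2} / P {ω | Z ω = t.1})) t := by
  classical
  rw [← lintegral_indicator MeasurableSet.of_discrete]
  have h1 := lintegral_comp_eq_tsum P (fun ω => ((Z ω, Y ω, X ω), W ω))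
    (fun t => T.indicator (fun s => P {ω | Z ω = s.1 ∧ X ω = s.2.2} / P {ω | Z ω = s.1} /
      (P {ω | W ω = t.2 ∧ X ω = s.2.2} / P {ω | W ω = t.2})) t.1)
  refine (le_of_eq ?_).trans (h1.trans_le ?_)
  · refine lintegral_congr fun ω => ?_
    simp only [Set.indicator_apply, Set.mem_preimage]
  rw [ENNReal.tsum_prod' (α := γ × β × α) (β := κ)]
  refine ENNReal.tsum_le_tsum fun t => ?_
  by_cases ht : t ∈ T
  swap
  · simp [Set.indicator_of_notMem ht]
  simp only [Set.indicator_of_mem ht]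
  obtain ⟨z, y, x⟩ := t
  have h2 : P {ω | Z ω = z ∧ Y ω = y} = ∑' w, P {ω | Z ω = z ∧ Y ω = y ∧ W ω = w} := by
    rw [← tsum_measure_and_eq P W]
    simp only [and_assoc]
  rw [h2, mul_comm, ← ENNReal.tsum_mul_left]
  refine ENNReal.tsum_le_tsum fun w => ?_
  have e : {ω | ((Z ω, Y ω, X ω), W ω) = ((z, y, x), w)} =
      {ω | Z ω = z ∧ Y ω = y ∧ W ω = w ∧ X ω = x} := by
    ext ω; simp only [Prod.mk.injEq, Set.mem_ofPred_eq]; tauto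
  rw [e]
  by_cases h0 : P {ω | Z ω = z ∧ Y ω = y ∧ W ω = w ∧ X ω = x} = 0
  · simp [h0]
  have hw : P {ω | W ω = w} ≠ 0 := fun h => h0 (measure_mono_null (fun ω hω => hω.2.2.1) h)
  have hwx : P {ω | W ω = w ∧ X ω = x} ≠ 0 := fun h => h0 (measure_mono_null (fun ω hω => hω.2.2) h)
  have hwt : P {ω | W ω = w} ≠ ∞ := measure_ne_top _ _
  have hwxt : P {ω | W ω = w ∧ X ω = x} ≠ ∞ := measure_ne_top _ _
  have h3 : P {ω | Z ω = z ∧ Y ω = y ∧ W ω = w ∧ X ω = x} =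
      P {ω | Z ω = z ∧ Y ω = y ∧ W ω = w} * (P {ω | W ω = w ∧ X ω = x} / P {ω | W ω = w}) := by
    rw [← mul_div_assoc, ← hM z y w x, ENNReal.mul_div_cancel_right hw hwt]
  rw [h3, mul_comm (P {ω | Z ω = z ∧ Y ω = y ∧ W ω = w}), ← mul_assoc, ENNReal.div_mul_cancel]
  · exact (ENNReal.div_pos hwx hwt).ne'
  · exact ENNReal.div_ne_top hwxt hw

theorem ae_measure_fiber_ne_zero (P : Measure Ω) (W : Ω → κ) :
    ∀ᵐ ω ∂P, P {ω' | W ω' = W ω} ≠ 0 := by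
  rw [ae_iff, ← tsum_measure_inter_fiber P W, ENNReal.tsum_eq_zero]
  intro w
  by_cases h : P {ω' | W ω' = w} = 0
  · exact measure_mono_null (fun ω hω => hω.2) h
  · convert! measure_empty (μ := P)
    ext ω
    simp only [Set.mem_inter_iff, Set.mem_ofPred_eq, not_not, Set.mem_preimage,
      Set.mem_singleton_iff, Set.mem_empty_iff_false, iff_false, not_and]
    rintro h1 rfl
    exact h h1

/-- This is `log t ≤ t - 1` at `t = (1 + s/4) u / v`, with `log (1 + s/4) ≥ s/5`; `s` will be the
indicator of the correlation event. The terms are arranged so that no subtraction occurs in `ℝ≥0∞`.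
-/
theorem log_ratio_tilt {u v s : ℝ} (hu : 0 < u) (hu1 : u ≤ 1) (hv : 0 < v) (hv1 : v ≤ 1)
    (hs : s = 0 ∨ s = 1) :
    ENNReal.ofReal (-Real.log v) + ENNReal.ofReal (s / 5) + 1 ≤
      ENNReal.ofReal (-Real.log u) + ENNReal.ofReal ((1 + s / 4) * (u / v)) := by
  have hs0 : 0 ≤ s := by rcases hs with rfl | rfl <;> norm_num
  have h1 := Real.log_le_sub_one_of_pos (show 0 < (1 + s / 4) * (u / v) by positivity)
  rw [Real.log_mul (by positivity) (by positivity), Real.log_div hu.ne' hv.ne'] at h1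
  have h2 : s / 5 ≤ Real.log (1 + s / 4) := by
    have := Real.one_sub_inv_le_log_of_pos (show (0 : ℝ) < 1 + s / 4 by positivity)
    refine le_trans ?_ this
    rcases hs with rfl | rfl <;> norm_num
  have hlu := Real.log_nonpos hu.le hu1
  have hlv := Real.log_nonpos hv.le hv1
  rw [← ENNReal.ofReal_one, ← ENNReal.ofReal_add (by linarith) (by positivity),
    ← ENNReal.ofReal_add (by linarith [show 0 ≤ s / 5 by positivity]) (by positivity),
    ← ENNReal.ofReal_add (by linarith) (by positivity)]
  exact ENNReal.ofReal_le_ofReal (by linarith)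

/-- Under the Markov hypothesis `H(X | W) = H(X | Z, Y, W)`, so the entropy gap is `I(X ; Y, W | Z)
≥ I(X ; Y | Z)`. As entropies may be infinite, differences are avoided: `log_ratio_tilt` is
integrated with `u = P(X | Z)` and `v = P(X | W)`. The ratio `u / v` has integral at most `1`, and
at most `2/3 P(S)` over the correlation event `S`, which again leaves `1/5 - 1/6 = 1/30`. -/
theorem condEntropy_add_le (P : Measure Ω) [IsProbabilityMeasure P]
    (X : Ω → α) (Y : Ω → β) (Z : Ω → γ) (W : Ω → κ)
    (hM : ∀ z y w x, P {ω | Z ω = z ∧ Y ω = y ∧ W ω = w ∧ X ω = x} * P {ω | W ω = w} =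
      P {ω | Z ω = z ∧ Y ω = y ∧ W ω = w} * P {ω | W ω = w ∧ X ω = x}) :
    condEntropy P X W + P (corrSet P X Y Z) / 30 ≤ condEntropy P X Z := by
  classical
  set S := corrSet P X Y Z with hS
  set u : Ω → ℝ≥0∞ := fun ω => P {ω' | Z ω' = Z ω ∧ X ω' = X ω} / P {ω' | Z ω' = Z ω} with hu
  set v : Ω → ℝ≥0∞ := fun ω => P {ω' | W ω' = W ω ∧ X ω' = X ω} / P {ω' | W ω' = W ω} with hv
  set T : Set (γ × β × α) := {t | 3 * (P {ω' | Z ω' = t.1 ∧ Y ω' = t.2.1} *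
    P {ω' | Z ω' = t.1 ∧ X ω' = t.2.2}) ≤
    2 * (P {ω' | Z ω' = t.1 ∧ Y ω' = t.2.1 ∧ X ω' = t.2.2} * P {ω' | Z ω' = t.1})} with hT
  have hST : (fun ω => (Z ω, Y ω, X ω)) ⁻¹' T = S := rfl
  have hprob : ∀ t : γ × β × α, P {ω | Z ω = t.1 ∧ X ω = t.2.2} / P {ω | Z ω = t.1} ≤ 1 :=
    fun t => ENNReal.div_le_of_le_mul
      (by rw [one_mul]; exact measure_mono fun ω hω => hω.1)
  have hone : ∫⁻ ω, u ω / v ω ∂P ≤ 1 := by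
    have := setLIntegral_likelihoodRatio_le P X Y Z W hM Set.univ
    simp only [Set.preimage_univ, Measure.restrict_univ, Set.indicator_univ] at this
    refine this.trans ?_
    rw [ENNReal.tsum_prod']
    calc _ ≤ ∑' z, P {ω | Z ω = z} := ?_
      _ = 1 := by
        have := tsum_measure_and_eq P Z (fun _ => True)
        simpa using this
    refine ENNReal.tsum_le_tsum fun z => ?_
    rw [ENNReal.tsum_prod']
    simp only [div_eq_mul_inv]
    simp_rw [ENNReal.tsum_mul_left, ENNReal.tsum_mul_right,
      tsum_measure_and_eq P X (fun ω => Z ω = z), tsum_measure_and_eq P Y (fun ω => Z ω = z)]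
    exact mul_le_of_le_one_right' (ENNReal.mul_inv_le_one _)
  have hSint : ∫⁻ ω in S, u ω / v ω ∂P ≤ 2 / 3 * P S := by
    have h1 := setLIntegral_likelihoodRatio_le P X Y Z W hM T
    rw [hST] at h1
    refine h1.trans ?_
    have h2 := lintegral_comp_eq_tsum P (fun ω => (Z ω, Y ω, X ω)) (T.indicator 1)
    have h3 : ∫⁻ ω, T.indicator (1 : γ × β × α → ℝ≥0∞) (Z ω, Y ω, X ω) ∂P = P S := by
      rw [← hST, ← lintegral_indicator_one MeasurableSet.of_discrete]
      rfl
    rw [← h3, h2, ← ENNReal.tsum_mul_left]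
    refine ENNReal.tsum_le_tsum fun t => ?_
    by_cases ht : t ∈ T
    swap
    · simp [Set.indicator_of_notMem ht]
    simp only [Set.indicator_of_mem ht, Pi.one_apply, one_mul]
    have e : {ω | (Z ω, Y ω, X ω) = t} =
        {ω | Z ω = t.1 ∧ Y ω = t.2.1 ∧ X ω = t.2.2} := by
      ext ω; simp only [Prod.ext_iff, Set.mem_ofPred_eq]
    rw [e, ← mul_div_assoc]
    by_cases h0 : P {ω | Z ω = t.1} = 0
    · have : P {ω | Z ω = t.1 ∧ Y ω = t.2.1} = 0 := measure_mono_null (fun ω hω => hω.1) h0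
      simp [this]
    refine ENNReal.div_le_of_le_mul ?_
    have h4 : 3 * (P {ω' | Z ω' = t.1 ∧ Y ω' = t.2.1} * P {ω' | Z ω' = t.1 ∧ X ω' = t.2.2}) ≤
      2 * (P {ω' | Z ω' = t.1 ∧ Y ω' = t.2.1 ∧ X ω' = t.2.2} * P {ω' | Z ω' = t.1}) := ht
    calc _ = 3⁻¹ * (3 * (P {ω' | Z ω' = t.1 ∧ Y ω' = t.2.1} *
            P {ω' | Z ω' = t.1 ∧ X ω' = t.2.2})) := by
          rw [← mul_assoc, ENNReal.inv_mul_cancel (by norm_num) (by norm_num), one_mul]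
      _ ≤ 3⁻¹ * (2 * (P {ω' | Z ω' = t.1 ∧ Y ω' = t.2.1 ∧ X ω' = t.2.2} *
            P {ω' | Z ω' = t.1})) := by gcongr
      _ = _ := by rw [div_eq_mul_inv]; ring
  have hpt : ∀ᵐ ω ∂P, ENNReal.ofReal (-Real.log (v ω).toReal) + S.indicator (fun _ => 1 / 5) ω + 1 ≤
      ENNReal.ofReal (-Real.log (u ω).toReal) +
        (u ω / v ω + 4⁻¹ * S.indicator (fun ω => u ω / v ω) ω) := by
    filter_upwards [ae_measure_fiber_ne_zero P Z, ae_measure_fiber_ne_zero P W,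
      ae_measure_fiber_ne_zero P (fun ω => (Z ω, X ω)),
      ae_measure_fiber_ne_zero P (fun ω => (W ω, X ω))] with ω hZ hW hZX hWX
    simp only [Prod.mk.injEq] at hZX hWX
    have hu0 : u ω ≠ 0 := (ENNReal.div_pos hZX (measure_ne_top _ _)).ne'
    have hv0 : v ω ≠ 0 := (ENNReal.div_pos hWX (measure_ne_top _ _)).ne'
    have hu1 : u ω ≤ 1 := ENNReal.div_le_of_le_mul
      (by rw [one_mul]; exact measure_mono fun ω hω => hω.1)
    have hv1 : v ω ≤ 1 := ENNReal.div_le_of_le_mul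
      (by rw [one_mul]; exact measure_mono fun ω hω => hω.1)
    have hut : u ω ≠ ∞ := (hu1.trans_lt ENNReal.one_lt_top).ne
    have hvt : v ω ≠ ∞ := (hv1.trans_lt ENNReal.one_lt_top).ne
    have hup := ENNReal.toReal_pos hu0 hut
    have hvp := ENNReal.toReal_pos hv0 hvt
    have hu1' : (u ω).toReal ≤ 1 := by simpa using ENNReal.toReal_mono ENNReal.one_ne_top hu1
    have hv1' : (v ω).toReal ≤ 1 := by simpa using ENNReal.toReal_mono ENNReal.one_ne_top hv1
    have hq : ENNReal.ofReal ((u ω).toReal / (v ω).toReal) = u ω / v ω := by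
      rw [ENNReal.ofReal_div_of_pos hvp, ENNReal.ofReal_toReal hut, ENNReal.ofReal_toReal hvt]
    by_cases hω : ω ∈ S
    · have := log_ratio_tilt hup hu1' hvp hv1' (s := 1) (Or.inr rfl)
      rw [ENNReal.ofReal_mul (by norm_num), hq, ENNReal.ofReal_add (by norm_num) (by norm_num),
        ENNReal.ofReal_div_of_pos (by norm_num), ENNReal.ofReal_div_of_pos (by norm_num)] at this
      simp only [Set.indicator_of_mem hω]
      refine (le_of_eq ?_).trans (this.trans (le_of_eq ?_)) <;> simp [add_mul]
    · have := log_ratio_tilt hup hu1' hvp hv1' (s := 0) (Or.inl rfl)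
      rw [ENNReal.ofReal_mul (by norm_num), hq] at this
      simpa [Set.indicator_of_notMem hω] using this
  have hint := lintegral_mono_ae hpt
  rw [lintegral_add_right _ measurable_const, lintegral_add_right _ Measurable.of_discrete,
    lintegral_add_right _ Measurable.of_discrete, lintegral_add_right _ Measurable.of_discrete,
    lintegral_const_mul _ Measurable.of_discrete, lintegral_indicator MeasurableSet.of_discrete,
    lintegral_indicator MeasurableSet.of_discrete, lintegral_const, lintegral_const] at hint
  simp only [measure_univ, mul_one, MeasurableSet.of_discrete, Measure.restrict_apply,
    Set.univ_inter] at hint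
  have hfin : condEntropy P X W + 1 / 5 * P S + 1 ≤
      condEntropy P X Z + (1 + 4⁻¹ * (2 / 3 * P S)) :=
    hint.trans (add_le_add_right (add_le_add hone (mul_le_mul_right hSint _)) _)
  have hPS : P S ≠ ∞ := measure_ne_top _ _
  have hsplit : 1 / 5 * P S = P S / 30 + 4⁻¹ * (2 / 3 * P S) := by
    rw [← ENNReal.toReal_eq_toReal_iff']
    · rw [ENNReal.toReal_add]
      · simp only [ENNReal.toReal_mul, ENNReal.toReal_div, ENNReal.toReal_inv]
        norm_num
        ring
      · exact ENNReal.div_ne_top hPS (by norm_num)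
      · finiteness
    · finiteness
    · exact ENNReal.add_ne_top.2 ⟨ENNReal.div_ne_top hPS (by norm_num), by finiteness⟩
  rw [hsplit] at hfin
  have hc : 1 + 4⁻¹ * (2 / 3 * P S) ≠ ∞ := by finiteness
  refine (ENNReal.add_le_add_iff_right hc).1 (le_trans (le_of_eq ?_) hfin)
  ring

end Discrete

/-! ### Entropy against the length of a bit string. -/

theorem tsum_four_pow_length :
    ∑' m : List Bool, (4⁻¹ : ℝ≥0∞) ^ m.length * 2⁻¹ = 1 := by
  rw [← (Equiv.sigmaFiberEquiv (List.length (α := Bool))).tsum_eq, ENNReal.tsum_sigma']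
  have h : ∀ n : ℕ, ∑' m : {l : List Bool // l.length = n},
      (4⁻¹ : ℝ≥0∞) ^ m.1.length * 2⁻¹ = 2⁻¹ ^ n * 2⁻¹ := by
    intro n
    have h1 : ∀ m : {l : List Bool // l.length = n},
      (4⁻¹ : ℝ≥0∞) ^ m.1.length * 2⁻¹ = 4⁻¹ ^ n * 2⁻¹ := fun m => by rw [m.2]
    simp_rw [h1]
    change ∑' m : List.Vector Bool n, (4⁻¹ : ℝ≥0∞) ^ n * 2⁻¹ = 2⁻¹ ^ n * 2⁻¹
    rw [tsum_fintype, Finset.sum_const, Finset.card_univ, card_vector, Fintype.card_bool,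
      nsmul_eq_mul, ← mul_assoc]
    congr 1
    push_cast
    rw [← mul_pow]
    congr 1
    rw [show (4 : ℝ≥0∞) = 2 * 2 by norm_num, ENNReal.mul_inv (by norm_num) (by norm_num),
      ← mul_assoc, ENNReal.mul_inv_cancel (by norm_num) (by norm_num), one_mul]
  refine (tsum_congr h).trans ?_
  rw [ENNReal.tsum_mul_right, ENNReal.tsum_geometric, ENNReal.one_sub_inv_two, inv_inv,
    ENNReal.mul_inv_cancel (by norm_num) (by norm_num)]

/-- Gibbs' inequality against the law `4 ^ (-|m|) / 2` on bit strings, whose negative logarithm is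
`|m| log 4 + log 2`. Base 4 makes the weights summable: there are `2 ^ k` strings of length `k`. -/
theorem condEntropy_le_length {Ω γ : Type*} [MeasurableSpace Ω] [DiscreteMeasurableSpace Ω]
    [Countable γ] (P : Measure Ω) [IsProbabilityMeasure P] (X : Ω → List Bool) (Z : Ω → γ) :
    condEntropy P X Z ≤ ENNReal.ofReal (Real.log 4) * ∫⁻ ω, ((X ω).length : ℝ≥0∞) ∂P +
      ENNReal.ofReal (Real.log 2) := by
  set u : Ω → ℝ≥0∞ := fun ω => P {ω' | Z ω' = Z ω ∧ X ω' = X ω} / P {ω' | Z ω' = Z ω} with hu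
  set q : List Bool → ℝ≥0∞ := fun m => 4⁻¹ ^ m.length * 2⁻¹ with hq
  have hone : ∫⁻ ω, q (X ω) / u ω ∂P ≤ 1 := by
    have h1 := lintegral_comp_eq_tsum P (fun ω => (Z ω, X ω))
      (fun t => q t.2 / (P {ω' | Z ω' = t.1 ∧ X ω' = t.2} / P {ω' | Z ω' = t.1}))
    refine h1.trans_le ?_
    calc _ ≤ ∑' t : γ × List Bool, P {ω | Z ω = t.1} * q t.2 := by
          refine ENNReal.tsum_le_tsum fun t => ?_
          simp only [Prod.ext_iff]
          set a := P {ω | Z ω = t.1}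
          set b := P {ω | Z ω = t.1 ∧ X ω = t.2}
          have hat : a ≠ ∞ := measure_ne_top _ _
          have hbt : b ≠ ∞ := measure_ne_top _ _
          have hba : b ≤ a := measure_mono fun ω hω => hω.1
          by_cases hb : b = 0
          · simp [hb]
          have ha : a ≠ 0 := fun h => hb (le_antisymm (hba.trans_eq h) zero_le)
          rw [div_eq_mul_inv, ENNReal.inv_div (Or.inl hat) (Or.inl ha), mul_assoc,
            ENNReal.div_mul_cancel hb hbt, mul_comm]
      _ = 1 := by
          rw [ENNReal.tsum_prod']
          simp_rw [ENNReal.tsum_mul_left, hq, tsum_four_pow_length, mul_one]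
          simpa using tsum_measure_and_eq P Z (fun _ => True)
  have hpt : ∀ᵐ ω ∂P, ENNReal.ofReal (-Real.log (u ω).toReal) + 1 ≤
      ENNReal.ofReal (Real.log 4) * ((X ω).length : ℝ≥0∞) + ENNReal.ofReal (Real.log 2) +
        q (X ω) / u ω := by
    filter_upwards [ae_measure_fiber_ne_zero P (fun ω => (Z ω, X ω))] with ω hZX
    simp only [Prod.mk.injEq] at hZX
    have hu0 : u ω ≠ 0 := (ENNReal.div_pos hZX (measure_ne_top _ _)).ne'
    have hu1 : u ω ≤ 1 := ENNReal.div_le_of_le_mul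
      (by rw [one_mul]; exact measure_mono fun ω hω => hω.1)
    have hut : u ω ≠ ∞ := (hu1.trans_lt ENNReal.one_lt_top).ne
    have hup := ENNReal.toReal_pos hu0 hut
    have hu1' : (u ω).toReal ≤ 1 := by simpa using ENNReal.toReal_mono ENNReal.one_ne_top hu1
    have hqr : q (X ω) = ENNReal.ofReal (((4 : ℝ) ^ (X ω).length * 2)⁻¹) := by
      rw [mul_inv, ENNReal.ofReal_mul (by positivity), ← inv_pow,
        ENNReal.ofReal_pow (by norm_num), ENNReal.ofReal_inv_of_pos (by norm_num),
        ENNReal.ofReal_inv_of_pos (by norm_num)]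
      simp [hq]
    have hqu : q (X ω) / u ω = ENNReal.ofReal (((4 : ℝ) ^ (X ω).length * 2)⁻¹ / (u ω).toReal) := by
      rw [ENNReal.ofReal_div_of_pos hup, ENNReal.ofReal_toReal hut, hqr]
    have h1 := Real.log_le_sub_one_of_pos
      (show 0 < ((4 : ℝ) ^ (X ω).length * 2)⁻¹ / (u ω).toReal by positivity)
    rw [Real.log_div (by positivity) hup.ne', Real.log_inv, Real.log_mul (by positivity)
      (by norm_num), Real.log_pow] at h1
    have hlu := Real.log_nonpos hup.le hu1'
    have hl4 : 0 ≤ Real.log 4 := Real.log_nonneg (by norm_num)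
    have hl2 : 0 ≤ Real.log 2 := Real.log_nonneg (by norm_num)
    rw [hqu, ← ENNReal.ofReal_natCast, ← ENNReal.ofReal_mul hl4,
      ← ENNReal.ofReal_add (by positivity) hl2, ← ENNReal.ofReal_add (by positivity)
      (by positivity), ← ENNReal.ofReal_one, ← ENNReal.ofReal_add (by linarith) (by norm_num)]
    exact ENNReal.ofReal_le_ofReal (by linarith)
  have hint := lintegral_mono_ae hpt
  rw [lintegral_add_right _ measurable_const, lintegral_add_right _ Measurable.of_discrete,
    lintegral_add_right _ measurable_const, lintegral_const_mul _ Measurable.of_discrete,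
    lintegral_const, lintegral_const] at hint
  simp only [measure_univ, mul_one] at hint
  exact (ENNReal.add_le_add_iff_right ENNReal.one_ne_top).1
    (hint.trans (add_le_add_right hone _))

end ApproxCounting

/-! ### The path law of bits and memory states. -/

namespace ApproxCounting

namespace StreamingAlgorithm

variable (A : StreamingAlgorithm)

theorem trajectory_apply (s : ℕ) (x : Fin s → ℕ) (M : Fin (s + 1) → Mem) :
    A.trajectory s x M =
      A.init (M 0) * ∏ k : Fin s, A.step k (M k.castSucc) (x k) (M k.succ) := by
  classical
  induction s with
  | zero =>
    simp only [trajectory, PMF.map_apply, Finset.univ_eq_empty, Finset.prod_empty, mul_one]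
    rw [tsum_eq_single (M 0)]
    · rw [if_pos]
      ext k : 1
      rw [Fin.fin_one_eq_zero k]
    · intro m hm
      rw [if_neg]
      rintro rfl
      exact hm rfl
  | succ s ih =>
    simp only [trajectory, PMF.bind_apply, PMF.map_apply]
    rw [tsum_eq_single (Fin.init M : Fin (s + 1) → Mem), tsum_eq_single (M (Fin.last (s + 1))),
      if_pos, ih, Fin.prod_univ_castSucc]
    · simp only [Fin.init, mul_assoc]
      congr 1
    · exact (Fin.snoc_init_self M).symm
    · intro m hm
      rw [if_neg]
      intro h
      refine hm ?_
      rw [h]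
      simp
    · intro M' hM'
      refine mul_eq_zero_of_right _ (ENNReal.tsum_eq_zero.2 fun m => ?_)
      rw [if_neg]
      rintro rfl
      exact hM' (by simp)

theorem trajectory_map_init (s : ℕ) (x : Fin (s + 1) → ℕ) :
    (A.trajectory (s + 1) x).map (fun M => (Fin.init M : Fin (s + 1) → Mem)) =
      A.trajectory s (Fin.init x) := by
  simp only [trajectory, PMF.map_bind, PMF.map_comp]
  conv_rhs => rw [← PMF.bind_pure (A.trajectory s (Fin.init x))]
  congr 1
  ext1 M
  have : ((fun M => (Fin.init M : Fin (s + 1) → Mem)) ∘ fun m => (Fin.snoc M m : Fin (s + 2) → Mem))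
      = Function.const _ M := by
    ext1 m
    simp
  rw [this, PMF.map_const]

/-- Causality: later steps can be integrated out one at a time by `trajectory_map_init`. -/
theorem trajectory_map_eval_congr (s : ℕ) (x x' : Fin s → ℕ) (j : Fin (s + 1))
    (h : ∀ k : Fin s, (k : ℕ) < j → x k = x' k) :
    (A.trajectory s x).map (fun M => M j) = (A.trajectory s x').map (fun M => M j) := by
  induction s with
  | zero => rw [Subsingleton.elim x x']
  | succ s ih =>
    induction j using Fin.lastCases with
    | last =>
      have : x = x' := funext fun k => h k k.2
      rw [this]
    | cast j =>
      have e : ∀ y : Fin (s + 1) → ℕ, (A.trajectory (s + 1) y).map (fun M => M j.castSucc) =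
          (A.trajectory s (Fin.init y)).map (fun M => M j) := by
        intro y
        rw [← trajectory_map_init, PMF.map_comp]
        rfl
      rw [e, e]
      exact ih _ _ _ fun k hk => h k.castSucc hk

/-- The joint law of fair bits and of the memory states on the inputs `φ k (b k)` they encode. -/
noncomputable def bitLaw {n : ℕ} (φ : Fin n → Bool → ℕ) :
    PMF ((Fin n → Bool) × (Fin (n + 1) → Mem)) :=
  (PMF.uniformOfFintype (Fin n → Bool)).bind fun b =>
    (A.trajectory n fun k => φ k (b k)).map fun M => (b, M)

variable {n : ℕ} (φ : Fin n → Bool → ℕ)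

theorem bitLaw_apply (ω : (Fin n → Bool) × (Fin (n + 1) → Mem)) :
    A.bitLaw φ ω = PMF.uniformOfFintype (Fin n → Bool) ω.1 *
      A.trajectory n (fun k => φ k (ω.1 k)) ω.2 := by
  classical
  obtain ⟨b, M⟩ := ω
  rw [bitLaw, PMF.bind_apply, tsum_eq_single b]
  · congr 1
    rw [PMF.map_apply, tsum_eq_single M]
    · simp
    · intro M' h
      rw [if_neg]
      simpa using h.symm
  · intro b' h
    refine mul_eq_zero_of_right _ ?_
    rw [PMF.map_apply, ENNReal.tsum_eq_zero]
    intro M'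
    rw [if_neg]
    intro h'
    exact h (Prod.ext_iff.1 h').1.symm

theorem jointLaw_eq_map_bitLaw (D : PMF (Fin n → ℕ))
    (hD : D = (PMF.uniformOfFintype (Fin n → Bool)).map fun b k => φ k (b k)) :
    A.jointLaw D = (A.bitLaw φ).toMeasure.map
      fun ω => ((fun k => φ k (ω.1 k) : Fin n → ℕ), ω.2) := by
  rw [PMF.toMeasure_map (hf := Measurable.of_discrete), jointLaw, bitLaw, hD, PMF.bind_map, PMF.map_bind]
  simp only [PMF.map_comp]
  rfl

theorem lintegral_bitLaw (f : (Fin n → Bool) × (Fin (n + 1) → Mem) → ℝ≥0∞) :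
    ∫⁻ ω, f ω ∂(A.bitLaw φ).toMeasure = ∑' ω, f ω * A.bitLaw φ ω := by
  rw [lintegral_countable']
  refine tsum_congr fun ω => ?_
  rw [PMF.toMeasure_apply_singleton _ _ (MeasurableSet.singleton _)]

theorem lintegral_bitLaw_eq_sum (f : (Fin n → Bool) × (Fin (n + 1) → Mem) → ℝ≥0∞) :
    ∫⁻ ω, f ω ∂(A.bitLaw φ).toMeasure =
      ∑ b : Fin n → Bool, PMF.uniformOfFintype (Fin n → Bool) b *
        ∫⁻ M, f (b, M) ∂(A.trajectory n fun k => φ k (b k)).toMeasure := by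
  rw [lintegral_bitLaw, ENNReal.tsum_prod', tsum_fintype]
  refine Finset.sum_congr rfl fun b _ => ?_
  rw [lintegral_countable', ← ENNReal.tsum_mul_left]
  refine tsum_congr fun M => ?_
  rw [PMF.toMeasure_apply_singleton _ _ (MeasurableSet.singleton _), bitLaw_apply]
  ring

theorem lintegral_bitLaw_fst (f : (Fin n → Bool) → ℝ≥0∞) :
    ∫⁻ ω, f ω.1 ∂(A.bitLaw φ).toMeasure =
      ∫⁻ b, f b ∂(PMF.uniformOfFintype (Fin n → Bool)).toMeasure := by
  rw [lintegral_bitLaw_eq_sum, lintegral_countable', tsum_fintype]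
  refine Finset.sum_congr rfl fun b _ => ?_
  rw [PMF.toMeasure_apply_singleton _ _ (MeasurableSet.singleton _)]
  simp [mul_comm]

/-- The state reached before a bit is read is independent of that bit. -/
theorem measure_state_and_bit (j : Fin n) (m : Mem) (a : Bool) :
    2 * (A.bitLaw φ).toMeasure {ω | ω.2 j.castSucc = m ∧ ω.1 j = a} =
      (A.bitLaw φ).toMeasure {ω | ω.2 j.castSucc = m} := by
  classical
  set μ := (A.bitLaw φ).toMeasure
  have key : ∀ a : Bool, μ {ω | ω.2 j.castSucc = m ∧ ω.1 j = a} =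
      ∑ b : Fin n → Bool, PMF.uniformOfFintype (Fin n → Bool) b * (if b j = a then
        ((A.trajectory n fun k => φ k (b k)).map fun M => M j.castSucc) m else 0) := by
    intro a
    rw [← lintegral_indicator_one (MeasurableSet.of_discrete), lintegral_bitLaw_eq_sum]
    refine Finset.sum_congr rfl fun b _ => ?_
    congr 1
    by_cases hb : b j = a
    · rw [if_pos hb, ← PMF.toMeasure_apply_singleton _ _ (MeasurableSet.singleton _),
        ← PMF.toMeasure_map (hf := Measurable.of_discrete), Measure.map_apply Measurable.of_discrete
        (MeasurableSet.singleton _), ← lintegral_indicator_one MeasurableSet.of_discrete]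
      refine lintegral_congr fun M => ?_
      simp [Set.indicator_apply, hb]
    · simp [hb]
  -- Flipping bit `j` preserves the uniform law and, by causality, the law of the state before input
  -- `j`.
  have hflip : μ {ω | ω.2 j.castSucc = m ∧ ω.1 j = !a} =
      μ {ω | ω.2 j.castSucc = m ∧ ω.1 j = a} := by
    have hinv : Function.Involutive fun b : Fin n → Bool => Function.update b j (!(b j)) := by
      intro b
      simp
    rw [key, key, ← Equiv.sum_comp hinv.toPerm]
    refine Finset.sum_congr rfl fun b _ => ?_
    simp only [Function.Involutive.coe_toPerm, Function.update_self, PMF.uniformOfFintype_apply]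
    congr 1
    have : (!b j) = (!a) ↔ b j = a := by simp
    simp only [this]
    refine if_congr Iff.rfl ?_ rfl
    rw [trajectory_map_eval_congr A n _ (fun k => φ k (b k)) j.castSucc]
    intro k hk
    have : k ≠ j := by
      rintro rfl
      simp at hk
    rw [Function.update_of_ne this]
  have hU : {ω : (Fin n → Bool) × (Fin (n + 1) → Mem) | ω.2 j.castSucc = m} =
      {ω | ω.2 j.castSucc = m ∧ ω.1 j = a} ∪ {ω | ω.2 j.castSucc = m ∧ ω.1 j = !a} := by
    ext ω
    cases a <;> cases h : ω.1 j <;> simp [h]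
  rw [hU, measure_union _ MeasurableSet.of_discrete, hflip, two_mul]
  refine Set.disjoint_left.2 ?_
  rintro ω ⟨_, h1⟩ ⟨_, h2⟩
  rw [h1] at h2
  simp at h2

end StreamingAlgorithm

/-! ### Conditional independence by exchanging pieces of two paths. -/

section Splice

variable {n : ℕ}

open Classical in
/-- The path which takes the bits with index in `I` and the states with index in `J` from `ω'`, and
all others from `ω`. -/
noncomputable def splice (I : Set (Fin n)) (J : Set (Fin (n + 1)))
    (ω ω' : (Fin n → Bool) × (Fin (n + 1) → Mem)) : (Fin n → Bool) × (Fin (n + 1) → Mem) :=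
  (fun k => if k ∈ I then ω'.1 k else ω.1 k, fun k => if k ∈ J then ω'.2 k else ω.2 k)

variable {I : Set (Fin n)} {J : Set (Fin (n + 1))}

theorem splice_splice (ω ω' : (Fin n → Bool) × (Fin (n + 1) → Mem)) :
    splice I J (splice I J ω ω') (splice I J ω' ω) = ω := by
  ext k
  · by_cases h : k ∈ I <;> simp [splice, h]
  · by_cases h : k ∈ J <;> simp [splice, h]

/-- The states of the two paths agree at the boundary of the spliced region. -/
def SpliceCompat (I : Set (Fin n)) (J : Set (Fin (n + 1))) (M M' : Fin (n + 1) → Mem) : Prop :=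
  ∀ k : Fin n, (¬ (k.castSucc ∈ J ↔ k ∈ I) → M k.castSucc = M' k.castSucc) ∧
    (¬ (k.succ ∈ J ↔ k ∈ I) → M k.succ = M' k.succ)

/-- The weight of a path is a product of one-step weights. Compatibility says that any state on the
boundary of the region is common to both paths, so each step of a spliced path is a step of one of
the originals, and the exchange merely permutes factors. -/
theorem bitLaw_splice_mul (A : StreamingAlgorithm) (φ : Fin n → Bool → ℕ)
    {ω ω' : (Fin n → Bool) × (Fin (n + 1) → Mem)} (h : SpliceCompat I J ω.2 ω'.2) :
    A.bitLaw φ (splice I J ω ω') * A.bitLaw φ (splice I J ω' ω) =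
      A.bitLaw φ ω * A.bitLaw φ ω' := by
  simp only [StreamingAlgorithm.bitLaw_apply, StreamingAlgorithm.trajectory_apply,
    PMF.uniformOfFintype_apply]
  have hinit : A.init ((splice I J ω ω').2 0) * A.init ((splice I J ω' ω).2 0) =
      A.init (ω.2 0) * A.init (ω'.2 0) := by
    by_cases h0 : (0 : Fin (n + 1)) ∈ J <;> simp [splice, h0, mul_comm]
  have hstep : (∏ k : Fin n, A.step k ((splice I J ω ω').2 k.castSucc)
        (φ k ((splice I J ω ω').1 k)) ((splice I J ω ω').2 k.succ)) *
      (∏ k : Fin n, A.step k ((splice I J ω' ω).2 k.castSucc)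
        (φ k ((splice I J ω' ω).1 k)) ((splice I J ω' ω).2 k.succ)) =
      (∏ k : Fin n, A.step k (ω.2 k.castSucc) (φ k (ω.1 k)) (ω.2 k.succ)) *
      (∏ k : Fin n, A.step k (ω'.2 k.castSucc) (φ k (ω'.1 k)) (ω'.2 k.succ)) := by
    rw [← Finset.prod_mul_distrib, ← Finset.prod_mul_distrib]
    refine Finset.prod_congr rfl fun k _ => ?_
    obtain ⟨h1, h2⟩ := h k
    by_cases hI : k ∈ I <;> by_cases hc : k.castSucc ∈ J <;> by_cases hs : k.succ ∈ J <;>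
      simp [splice, hI, hc, hs] at h1 h2 ⊢ <;> simp [h1, h2, mul_comm]
  calc _ = (Fintype.card (Fin n → Bool) : ℝ≥0∞)⁻¹ * (Fintype.card (Fin n → Bool) : ℝ≥0∞)⁻¹ *
        ((A.init ((splice I J ω ω').2 0) * A.init ((splice I J ω' ω).2 0)) * (
        (∏ k : Fin n, A.step k ((splice I J ω ω').2 k.castSucc)
        (φ k ((splice I J ω ω').1 k)) ((splice I J ω ω').2 k.succ)) *
      (∏ k : Fin n, A.step k ((splice I J ω' ω).2 k.castSucc)
        (φ k ((splice I J ω' ω).1 k)) ((splice I J ω' ω).2 k.succ)))) := by ring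
    _ = _ := by rw [hinit, hstep]; ring

/-- On an event `T` that fixes the boundary states, a function `F` of what lies outside the spliced
region and a function `G` of what lies inside are conditionally independent. -/
theorem setLIntegral_mul_setLIntegral_of_splice (A : StreamingAlgorithm) (φ : Fin n → Bool → ℕ)
    (I : Set (Fin n)) (J : Set (Fin (n + 1)))
    (T : Set ((Fin n → Bool) × (Fin (n + 1) → Mem)))
    (hT : ∀ ω ∈ T, ∀ ω' ∈ T, SpliceCompat I J ω.2 ω'.2 ∧ splice I J ω ω' ∈ T)
    (F G : (Fin n → Bool) × (Fin (n + 1) → Mem) → ℝ≥0∞)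
    (hF : ∀ ω ∈ T, ∀ ω' ∈ T, F (splice I J ω ω') = F ω)
    (hG : ∀ ω ∈ T, ∀ ω' ∈ T, G (splice I J ω ω') = G ω') :
    (∫⁻ ω in T, F ω ∂(A.bitLaw φ).toMeasure) * ∫⁻ ω in T, G ω ∂(A.bitLaw φ).toMeasure =
      (∫⁻ ω in T, F ω * G ω ∂(A.bitLaw φ).toMeasure) * (A.bitLaw φ).toMeasure T := by
  classical
  rw [← lintegral_indicator_one (MeasurableSet.of_discrete (s := T)),
    ← lintegral_indicator MeasurableSet.of_discrete,
    ← lintegral_indicator MeasurableSet.of_discrete,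
    ← lintegral_indicator MeasurableSet.of_discrete]
  simp only [StreamingAlgorithm.lintegral_bitLaw]
  set p := A.bitLaw φ
  have hprod : ∀ f g : (Fin n → Bool) × (Fin (n + 1) → Mem) → ℝ≥0∞,
      (∑' ω, f ω * p ω) * ∑' ω, g ω * p ω =
        ∑' t : ((Fin n → Bool) × (Fin (n + 1) → Mem)) × ((Fin n → Bool) × (Fin (n + 1) → Mem)),
          f t.1 * g t.2 * (p t.1 * p t.2) := by
    intro f g
    rw [← ENNReal.tsum_mul_right, ENNReal.tsum_prod' (α := (Fin n → Bool) × (Fin (n + 1) → Mem))]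
    refine tsum_congr fun ω => ?_
    refine ENNReal.tsum_mul_left.symm.trans (tsum_congr fun ω' => ?_)
    ring
  rw [hprod, hprod]
  -- For two independent copies `ω, ω'`, the exchange is an involution that preserves the product
  -- weight on `T × T` and turns `F ω * G ω'` into `F ω * G ω`.
  have hinv : Function.Involutive fun t : ((Fin n → Bool) × (Fin (n + 1) → Mem)) ×
      ((Fin n → Bool) × (Fin (n + 1) → Mem)) => (splice I J t.1 t.2, splice I J t.2 t.1) := by
    intro t
    simp [splice_splice]
  rw [← Equiv.tsum_eq hinv.toPerm]
  refine tsum_congr fun t => ?_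
  obtain ⟨ω, ω'⟩ := t
  simp only [Function.Involutive.coe_toPerm]
  by_cases h : ω ∈ T ∧ ω' ∈ T
  · obtain ⟨h1, h2⟩ := h
    obtain ⟨hc, h3⟩ := hT ω h1 ω' h2
    obtain ⟨-, h4⟩ := hT ω' h2 ω h1
    simp only [p, bitLaw_splice_mul A φ hc]
    simp [h1, h2, h3, h4, hF ω h1 ω' h2, hG ω' h2 ω h1]
  · have h' : ¬ (splice I J ω ω' ∈ T ∧ splice I J ω' ω ∈ T) := by
      rintro ⟨h3, h4⟩
      refine h ⟨?_, ?_⟩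
      · simpa [splice_splice] using (hT _ h3 _ h4).2
      · simpa [splice_splice] using (hT _ h4 _ h3).2
    rw [not_and_or] at h h'
    rcases h with h | h <;> rcases h' with h' | h' <;> simp [h, h']

end Splice

end ApproxCounting

/-! ### The Markov property and telescoping of entropies. -/

namespace ApproxCounting

variable {n : ℕ}

/-- Splice everything up to and including input `j`, with the states before it. The only boundary
state is the one after input `j`, and the event `ω.2 j.succ = w` fixes it. -/
theorem bitLaw_markov (A : StreamingAlgorithm) (φ : Fin n → Bool → ℕ) {j i : Fin n} (hji : j ≤ i)
    (z : Mem) (y : ℕ) (w x : Mem) :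
    (A.bitLaw φ).toMeasure {ω | ω.2 j.castSucc = z ∧ φ j (ω.1 j) = y ∧ ω.2 j.succ = w ∧
        ω.2 i.succ = x} * (A.bitLaw φ).toMeasure {ω | ω.2 j.succ = w} =
      (A.bitLaw φ).toMeasure {ω | ω.2 j.castSucc = z ∧ φ j (ω.1 j) = y ∧ ω.2 j.succ = w} *
        (A.bitLaw φ).toMeasure {ω | ω.2 j.succ = w ∧ ω.2 i.succ = x} := by
  classical
  set μ := (A.bitLaw φ).toMeasure
  have h := setLIntegral_mul_setLIntegral_of_splice A φ {k | k ≤ j} {k | (k : ℕ) ≤ j}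
    {ω | ω.2 j.succ = w} ?_ (Set.indicator {ω | ω.2 i.succ = x} 1)
    (Set.indicator {ω | ω.2 j.castSucc = z ∧ φ j (ω.1 j) = y} 1) ?_ ?_
  · have e : ∀ ω : (Fin n → Bool) × (Fin (n + 1) → Mem),
        Set.indicator {ω | ω.2 i.succ = x} (1 : (Fin n → Bool) × (Fin (n + 1) → Mem) → ℝ≥0∞) ω *
        Set.indicator {ω | ω.2 j.castSucc = z ∧ φ j (ω.1 j) = y} (1 : (Fin n → Bool) × (Fin (n + 1) → Mem) → ℝ≥0∞) ω =
        Set.indicator {ω : (Fin n → Bool) × (Fin (n + 1) → Mem) | ω.2 i.succ = x ∧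
          ω.2 j.castSucc = z ∧ φ j (ω.1 j) = y} (1 : (Fin n → Bool) × (Fin (n + 1) → Mem) → ℝ≥0∞) ω := by
      intro ω
      simp only [Set.indicator_apply, Set.mem_ofPred_eq, Pi.one_apply]
      split_ifs <;> simp_all
    simp only [e] at h
    rw [lintegral_indicator_one MeasurableSet.of_discrete,
      lintegral_indicator_one MeasurableSet.of_discrete,
      lintegral_indicator_one MeasurableSet.of_discrete,
      Measure.restrict_apply MeasurableSet.of_discrete,
      Measure.restrict_apply MeasurableSet.of_discrete,
      Measure.restrict_apply MeasurableSet.of_discrete] at h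
    have e1 : {ω : (Fin n → Bool) × (Fin (n + 1) → Mem) | ω.2 i.succ = x} ∩
        {ω | ω.2 j.succ = w} = {ω | ω.2 j.succ = w ∧ ω.2 i.succ = x} := by
      ext ω; simp only [Set.mem_inter_iff, Set.mem_ofPred_eq]; tauto
    have e2 : {ω : (Fin n → Bool) × (Fin (n + 1) → Mem) | ω.2 j.castSucc = z ∧
        φ j (ω.1 j) = y} ∩ {ω | ω.2 j.succ = w} =
        {ω | ω.2 j.castSucc = z ∧ φ j (ω.1 j) = y ∧ ω.2 j.succ = w} := by
      ext ω; simp only [Set.mem_inter_iff, Set.mem_ofPred_eq]; tauto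
    have e3 : {ω : (Fin n → Bool) × (Fin (n + 1) → Mem) | ω.2 i.succ = x ∧ ω.2 j.castSucc = z ∧
        φ j (ω.1 j) = y} ∩ {ω | ω.2 j.succ = w} =
        {ω | ω.2 j.castSucc = z ∧ φ j (ω.1 j) = y ∧ ω.2 j.succ = w ∧ ω.2 i.succ = x} := by
      ext ω; simp only [Set.mem_inter_iff, Set.mem_ofPred_eq]; tauto
    rw [e1, e2, e3] at h
    rw [← h, mul_comm]
  · intro ω hω ω' hω'
    have hω₁ : ω.2 j.succ = w := hω
    have hω₂ : ω'.2 j.succ = w := hω'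
    refine ⟨fun k => ⟨fun hk => ?_, fun hk => ?_⟩, ?_⟩
    · exact absurd Iff.rfl hk
    · have : k = j := by
        simp only [Set.mem_ofPred_eq, Fin.val_succ, Fin.le_def] at hk
        ext
        by_contra h
        exact hk (by omega)
      subst this
      exact hω₁.trans hω₂.symm
    · simpa [splice] using hω₁
  · intro ω _ ω' _
    have : ¬ ((i : ℕ) + 1 ≤ j) := by
      have := Fin.le_def.1 hji
      omega
    simp [splice, Set.indicator_apply, this]
  · intro ω _ ω' _
    simp [splice, Set.indicator_apply]

namespace StreamingAlgorithm

variable (A : StreamingAlgorithm) (φ : Fin n → Bool → ℕ)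

/-- The probability that the state after input `i` and input `j` are positively correlated given the
state before input `j`. -/
noncomputable def corrProb (i j : Fin n) : ℝ≥0∞ :=
  (A.bitLaw φ).toMeasure (corrSet (A.bitLaw φ).toMeasure (fun ω => ω.2 i.succ)
    (fun ω => φ j (ω.1 j)) (fun ω => ω.2 j.castSucc))

/-- Replacing the conditioning state `M_t` by `M_{t+1}` lowers the entropy by at least the
correlation term of input `t`, by `condEntropy_add_le`. The drops telescope from `M_0`, and the last
entropy is discarded. -/
theorem sum_corrProb_le_condEntropy (i : Fin n) :
    ∑ j ∈ Finset.Iic i, A.corrProb φ i j / 30 ≤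
      condEntropy (A.bitLaw φ).toMeasure (fun ω => ω.2 i.succ) (fun ω => ω.2 0) := by
  have h : ∀ t : ℕ, ∀ ht : t ≤ (i : ℕ) + 1,
      condEntropy (A.bitLaw φ).toMeasure (fun ω => ω.2 i.succ)
        (fun ω => ω.2 ⟨t, by omega⟩) + ∑ j ∈ Finset.univ.filter (fun j : Fin n => (j : ℕ) < t), A.corrProb φ i j / 30 ≤
      condEntropy (A.bitLaw φ).toMeasure (fun ω => ω.2 i.succ) (fun ω => ω.2 0) := by
    intro t
    induction t with
    | zero => intro _; simp
    | succ t ih =>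
      intro ht
      have hj : t < n := by omega
      refine le_trans ?_ (ih (by omega))
      have e : (Finset.univ.filter fun j : Fin n => (j : ℕ) < t + 1) =
          insert (⟨t, hj⟩ : Fin n) (Finset.univ.filter fun j : Fin n => (j : ℕ) < t) := by
        ext k
        simp only [Finset.mem_filter, Finset.mem_univ, true_and, Finset.mem_insert, Fin.ext_iff]
        omega
      rw [e, Finset.sum_insert (by simp), ← add_assoc]
      gcongr
      exact condEntropy_add_le (A.bitLaw φ).toMeasure (fun ω => ω.2 i.succ)
        (fun ω => φ ⟨t, hj⟩ (ω.1 ⟨t, hj⟩)) (fun ω => ω.2 (⟨t, hj⟩ : Fin n).castSucc)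
        (fun ω => ω.2 (⟨t, hj⟩ : Fin n).succ)
        (bitLaw_markov A φ (j := ⟨t, hj⟩) (i := i) (Fin.le_def.2 (by simp; omega)))
  refine le_trans ?_ (h (i + 1) le_rfl)
  refine le_trans (le_of_eq ?_) le_add_self
  refine Finset.sum_congr ?_ fun _ _ => rfl
  ext k
  rw [Finset.mem_Iic, Finset.mem_filter, Fin.le_def, Nat.lt_succ_iff]
  exact ⟨fun h => ⟨Finset.mem_univ _, h⟩, fun h => h.2⟩

theorem sum_corrProb_le_length (i : Fin n) :
    ∑ j ∈ Finset.Iic i, A.corrProb φ i j / 30 ≤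
      ENNReal.ofReal (Real.log 4) *
        ∫⁻ ω, ((ω.2 i.succ).length : ℝ≥0∞) ∂(A.bitLaw φ).toMeasure +
      ENNReal.ofReal (Real.log 2) :=
  (A.sum_corrProb_le_condEntropy φ i).trans
    (condEntropy_le_length (A.bitLaw φ).toMeasure (fun ω => ω.2 i.succ) (fun ω => ω.2 0))

theorem sum_corrProb_le_infoCost (D : PMF (Fin n → ℕ))
    (hD : D = (PMF.uniformOfFintype (Fin n → Bool)).map fun b k => φ k (b k)) :
    ∑ i, ∑ j ∈ Finset.Iic i, A.corrProb φ i j / 30 ≤ A.infoCost D := by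
  rw [infoCost]
  refine Finset.sum_le_sum fun i _ => Finset.sum_le_sum fun j _ => ?_
  have : IsProbabilityMeasure (A.jointLaw D) := by rw [jointLaw]; infer_instance
  refine le_trans (le_of_eq ?_) (measure_corrSet_le_condMutualInfo _ _ _ _)
  rw [jointLaw_eq_map_bitLaw A φ D hD, Measure.map_apply Measurable.of_discrete
    MeasurableSet.of_discrete, corrSet_map]
  rfl

theorem sum_corrProb_le_avgMemory (hn : n ≠ 0) (D : PMF (Fin n → ℕ))
    (hD : D = (PMF.uniformOfFintype (Fin n → Bool)).map fun b k => φ k (b k)) :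
    (∑ i, ∑ j ∈ Finset.Iic i, A.corrProb φ i j / 30) / n ≤
      ENNReal.ofReal (Real.log 4) * A.avgMemory D + ENNReal.ofReal (Real.log 2) := by
  have hn' : (n : ℝ≥0∞) ≠ 0 := by exact_mod_cast hn
  rw [avgMemory]
  refine ENNReal.div_le_of_le_mul ?_
  rw [add_mul, mul_assoc, ENNReal.div_mul_cancel hn' (ENNReal.natCast_ne_top n), Finset.mul_sum]
  have e : ENNReal.ofReal (Real.log 2) * n = ∑ _i : Fin n, ENNReal.ofReal (Real.log 2) := by
    simp [mul_comm]
  rw [e, ← Finset.sum_add_distrib]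
  refine Finset.sum_le_sum fun i _ => (A.sum_corrProb_le_length φ i).trans (le_of_eq ?_)
  rw [jointLaw_eq_map_bitLaw A φ D hD, lintegral_map Measurable.of_discrete Measurable.of_discrete]

end StreamingAlgorithm

/-! ### Resampling the insides of disjoint windows. -/

section Window

/-- The states strictly between the state before input `j` and the state after input `i`. -/
def interiorStates (j i : Fin n) : Set (Fin (n + 1)) := {k | (j : ℕ) < k ∧ (k : ℕ) ≤ i}

theorem lintegral_eq_tsum_fiber {Ω γ : Type*} [MeasurableSpace Ω] [DiscreteMeasurableSpace Ω]
    [Countable γ] (P : Measure Ω) (Z : Ω → γ) (F : Ω → ℝ≥0∞) :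
    ∫⁻ ω, F ω ∂P = ∑' z, ∫⁻ ω in Z ⁻¹' {z}, F ω ∂P := by
  rw [← lintegral_iUnion (fun _ => MeasurableSet.of_discrete)]
  · have : ⋃ z, Z ⁻¹' {z} = Set.univ := by ext; simp
    rw [this, Measure.restrict_univ]
  · intro a b hab
    refine Set.disjoint_left.2 fun ω h1 h2 => hab (h1.symm.trans h2)

-- On a fibre of the two end states, `F` sees only the outside and `E` only the inside, so they are
-- independent there, and restricting to `E` costs a factor of at least `c`. On fibres that are not
-- good nothing is demanded and `c ≤ 1` suffices; hence `F` needs invariance only for good end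
-- states.
open Classical in
theorem mul_lintegral_le_of_window (A : StreamingAlgorithm) (φ : Fin n → Bool → ℕ) {j i : Fin n}
    (hji : j ≤ i) (F : (Fin n → Bool) × (Fin (n + 1) → Mem) → ℝ≥0∞) (E : Set (Fin n → Bool))
    (Good : Mem → Mem → Prop) {c : ℝ≥0∞} (hc : c ≤ 1)
    (hF : ∀ ω ω', ω.2 j.castSucc = ω'.2 j.castSucc → ω.2 i.succ = ω'.2 i.succ →
      Good (ω.2 j.castSucc) (ω.2 i.succ) → F (splice (Set.Icc j i) (interiorStates j i) ω ω') = F ω)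
    (hE : ∀ b b' : Fin n → Bool, (∀ k ∈ Set.Icc j i, b k = b' k) → (b ∈ E ↔ b' ∈ E))
    (hgood : ∀ m m', Good m m' →
      c * (A.bitLaw φ).toMeasure {ω | ω.2 j.castSucc = m ∧ ω.2 i.succ = m'} ≤
        (A.bitLaw φ).toMeasure {ω | (ω.2 j.castSucc = m ∧ ω.2 i.succ = m') ∧ ω.1 ∈ E}) :
    c * ∫⁻ ω, F ω ∂(A.bitLaw φ).toMeasure ≤
      ∫⁻ ω, F ω * (if Good (ω.2 j.castSucc) (ω.2 i.succ) → ω.1 ∈ E then 1 else 0)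
        ∂(A.bitLaw φ).toMeasure := by
  set μ := (A.bitLaw φ).toMeasure
  set Z : (Fin n → Bool) × (Fin (n + 1) → Mem) → Mem × Mem :=
    fun ω => (ω.2 j.castSucc, ω.2 i.succ) with hZ
  rw [lintegral_eq_tsum_fiber μ Z, lintegral_eq_tsum_fiber μ Z, ← ENNReal.tsum_mul_left]
  refine ENNReal.tsum_le_tsum fun z => ?_
  obtain ⟨m, m'⟩ := z
  set T := Z ⁻¹' {(m, m')} with hT
  have hTe : T = {ω | ω.2 j.castSucc = m ∧ ω.2 i.succ = m'} := by
    ext ω; simp [hT, hZ]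
  have hmem : ∀ ω ∈ T, ω.2 j.castSucc = m ∧ ω.2 i.succ = m' := by
    intro ω hω; rw [hTe] at hω; exact hω
  by_cases hg : Good m m'
  swap
  · refine le_trans (mul_le_of_le_one_left' hc) (setLIntegral_mono' MeasurableSet.of_discrete ?_)
    intro ω hω
    obtain ⟨h1, h2⟩ := hmem ω hω
    rw [h1, h2, if_pos (fun h => absurd h hg), mul_one]
  have hji' := Fin.le_def.1 hji
  have hs := setLIntegral_mul_setLIntegral_of_splice A φ (Set.Icc j i) (interiorStates j i) T ?_ F
    (fun ω => if ω.1 ∈ E then 1 else 0) ?_ ?_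
  · have hE1 : ∫⁻ ω in T, (if ω.1 ∈ E then 1 else 0) ∂μ =
        μ {ω | (ω.2 j.castSucc = m ∧ ω.2 i.succ = m') ∧ ω.1 ∈ E} := by
      have : ∀ ω : (Fin n → Bool) × (Fin (n + 1) → Mem), (if ω.1 ∈ E then (1 : ℝ≥0∞) else 0) =
        Set.indicator {ω | ω.1 ∈ E} 1 ω := fun ω => by simp [Set.indicator_apply]
      simp_rw [this]
      rw [lintegral_indicator_one MeasurableSet.of_discrete,
        Measure.restrict_apply MeasurableSet.of_discrete, hTe]
      congr 1
      ext ω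
      simp [and_comm]
    have hF1 : ∫⁻ ω in T, F ω * (if Good (ω.2 j.castSucc) (ω.2 i.succ) → ω.1 ∈ E then 1 else 0) ∂μ =
        ∫⁻ ω in T, F ω * (if ω.1 ∈ E then 1 else 0) ∂μ := by
      refine setLIntegral_congr_fun MeasurableSet.of_discrete fun ω hω => ?_
      obtain ⟨h1, h2⟩ := hmem ω hω
      simp only [h1, h2, hg, true_imp_iff]
    rw [hF1]
    by_cases h0 : μ T = 0
    · rw [Measure.restrict_eq_zero.2 h0]
      simp
    have ht : μ T ≠ ∞ := measure_ne_top _ _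
    refine (ENNReal.mul_le_mul_iff_left h0 ht).1 ?_
    rw [← hs, hE1]
    have := hgood m m' hg
    rw [← hTe] at this
    calc c * (∫⁻ ω in T, F ω ∂μ) * μ T = (∫⁻ ω in T, F ω ∂μ) * (c * μ T) := by ring
      _ ≤ _ := by gcongr
  · intro ω hω ω' hω'
    obtain ⟨h1, h2⟩ := hmem ω hω
    obtain ⟨h3, h4⟩ := hmem ω' hω'
    refine ⟨fun k => ⟨fun hk => ?_, fun hk => ?_⟩, ?_⟩
    · have : k = j := by
        simp only [interiorStates, Set.mem_ofPred_eq, Set.mem_Icc, Fin.le_def,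
          Fin.val_castSucc] at hk
        ext
        by_contra h
        exact hk (by omega)
      subst this
      exact h1.trans h3.symm
    · have : k = i := by
        simp only [interiorStates, Set.mem_ofPred_eq, Set.mem_Icc, Fin.le_def,
          Fin.val_succ] at hk
        ext
        by_contra h
        exact hk (by omega)
      subst this
      exact h2.trans h4.symm
    · rw [hTe]
      simp [splice, interiorStates, h1, h2]
  · intro ω hω ω' hω'
    obtain ⟨h1, h2⟩ := hmem ω hω
    obtain ⟨h3, h4⟩ := hmem ω' hω'
    exact hF ω ω' (h1.trans h3.symm) (h2.trans h4.symm) (by rw [h1, h2]; exact hg)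
  · intro ω _ ω' _
    have := hE (splice (Set.Icc j i) (interiorStates j i) ω ω').1 ω'.1
      (fun k hk => by simp only [splice, if_pos hk])
    simp only [this]

theorem ite_mul_ite_one (p q : Prop) [Decidable p] [Decidable q] :
    (if p then (1 : ℝ≥0∞) else 0) * (if q then 1 else 0) = if q ∧ p then 1 else 0 := by
  split_ifs <;> simp_all

-- Induction on the windows: by disjointness, the requirement on the windows already treated is
-- unaffected by the inside of a new one, so it may be absorbed into `F`.
open Classical in
theorem pow_mul_lintegral_le_of_windows (A : StreamingAlgorithm) (φ : Fin n → Bool → ℕ)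
    {ι : Type*} (Q : Finset ι) (j i : ι → Fin n) (hji : ∀ q ∈ Q, j q ≤ i q)
    (hdisj : ∀ q ∈ Q, ∀ q' ∈ Q, q ≠ q' → i q < j q' ∨ i q' < j q)
    (F : (Fin n → Bool) × (Fin (n + 1) → Mem) → ℝ≥0∞) (E : ι → Set (Fin n → Bool))
    (Good : ι → Mem → Mem → Prop) {c : ℝ≥0∞} (hc : c ≤ 1)
    (hF : ∀ q ∈ Q, ∀ ω ω', ω.2 (j q).castSucc = ω'.2 (j q).castSucc →
      ω.2 (i q).succ = ω'.2 (i q).succ → Good q (ω.2 (j q).castSucc) (ω.2 (i q).succ) →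
      F (splice (Set.Icc (j q) (i q)) (interiorStates (j q) (i q)) ω ω') = F ω)
    (hE : ∀ q ∈ Q, ∀ b b' : Fin n → Bool, (∀ k ∈ Set.Icc (j q) (i q), b k = b' k) →
      (b ∈ E q ↔ b' ∈ E q))
    (hgood : ∀ q ∈ Q, ∀ m m', Good q m m' →
      c * (A.bitLaw φ).toMeasure {ω | ω.2 (j q).castSucc = m ∧ ω.2 (i q).succ = m'} ≤
        (A.bitLaw φ).toMeasure
          {ω | (ω.2 (j q).castSucc = m ∧ ω.2 (i q).succ = m') ∧ ω.1 ∈ E q}) :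
    c ^ Q.card * ∫⁻ ω, F ω ∂(A.bitLaw φ).toMeasure ≤
      ∫⁻ ω, F ω * (if ∀ q ∈ Q, Good q (ω.2 (j q).castSucc) (ω.2 (i q).succ) → ω.1 ∈ E q
        then 1 else 0) ∂(A.bitLaw φ).toMeasure := by
  induction Q using Finset.induction_on with
  | empty => simp
  | insert q₀ Q hq₀ ih =>
    have ih' := ih (fun q hq => hji q (Finset.mem_insert_of_mem hq))
      (fun q hq q' hq' => hdisj q (Finset.mem_insert_of_mem hq) q' (Finset.mem_insert_of_mem hq'))
      (fun q hq => hF q (Finset.mem_insert_of_mem hq))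
      (fun q hq => hE q (Finset.mem_insert_of_mem hq))
      (fun q hq => hgood q (Finset.mem_insert_of_mem hq))
    have h0 := Finset.mem_insert_self q₀ Q
    rw [Finset.card_insert_of_notMem hq₀, pow_succ', mul_assoc]
    refine (mul_le_mul_right ih' c).trans ?_
    have := mul_lintegral_le_of_window A φ (hji q₀ h0) (fun ω => F ω *
      (if ∀ q ∈ Q, Good q (ω.2 (j q).castSucc) (ω.2 (i q).succ) → ω.1 ∈ E q
        then 1 else 0)) (E q₀) (Good q₀) hc ?_ (hE q₀ h0) (hgood q₀ h0)
    · refine this.trans (le_of_eq (lintegral_congr fun ω => ?_))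
      rw [mul_assoc, ite_mul_ite_one]
      exact congrArg _ (if_congr (Finset.forall_mem_insert q₀ Q (fun q =>
        Good q (ω.2 (j q).castSucc) (ω.2 (i q).succ) → ω.1 ∈ E q)).symm rfl rfl)
    · intro ω ω' h1 h2 h3
      rw [hF q₀ h0 ω ω' h1 h2 h3]
      congr 1
      refine if_congr (forall₂_congr fun q hq => ?_) rfl rfl
      have hne : q ≠ q₀ := fun h => hq₀ (h ▸ hq)
      have hq' := Finset.mem_insert_of_mem (a := q) (b := q₀) hq
      have hd := hdisj q hq' q₀ h0 hne
      have hq1 := hji q hq'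
      have hq2 := hji q₀ h0
      rw [Fin.lt_def, Fin.lt_def] at hd
      rw [Fin.le_def] at hq1 hq2
      have e1 : (splice (Set.Icc (j q₀) (i q₀)) (interiorStates (j q₀) (i q₀)) ω ω').2
          (j q).castSucc = ω.2 (j q).castSucc := by
        simp only [splice]
        rw [if_neg]
        simp only [interiorStates, Set.mem_ofPred_eq, Fin.val_castSucc]
        omega
      have e2 : (splice (Set.Icc (j q₀) (i q₀)) (interiorStates (j q₀) (i q₀)) ω ω').2
          (i q).succ = ω.2 (i q).succ := by
        simp only [splice]
        rw [if_neg]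
        simp only [interiorStates, Set.mem_ofPred_eq, Fin.val_succ]
        omega
      rw [e1, e2]
      refine imp_congr Iff.rfl (hE q hq' _ _ fun k hk => ?_)
      simp only [splice]
      rw [if_neg]
      simp only [Set.mem_Icc, Fin.le_def] at hk ⊢
      omega

end Window

end ApproxCounting

/-! ### Deviations within a window, and good pairs of end states. -/

namespace ApproxCounting

variable {n : ℕ}

/-- The input `v k` if the bit is set, and `0` otherwise. -/
def bitInput (v : Fin n → ℕ) (k : Fin n) (b : Bool) : ℕ := if b = true then v k else 0

/-- The deviation of the input `k` from its mean `v k / 2`. -/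
noncomputable def bitDev (v : Fin n → ℕ) (k : Fin n) (b : Bool) : ℝ :=
  if b = true then (v k : ℝ) / 2 else -((v k : ℝ) / 2)

theorem bitDev_sq (v : Fin n → ℕ) (k : Fin n) (b : Bool) :
    bitDev v k b ^ 2 = (v k : ℝ) ^ 2 / 4 := by
  unfold bitDev
  split_ifs <;> ring

theorem bitDev_not (v : Fin n → ℕ) (k : Fin n) (b : Bool) :
    bitDev v k (!b) = -bitDev v k b := by
  cases b <;> simp [bitDev]

/-- The variance of a sum of independent centred terms; cross terms cancel under flipping the bit
`k₀`. -/
theorem sum_sq_sum_bitDev (v : Fin n → ℕ) (R : Finset (Fin n)) :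
    ∑ b : Fin n → Bool, (∑ k ∈ R, bitDev v k (b k)) ^ 2 =
      2 ^ n * ((∑ k ∈ R, (v k : ℝ) ^ 2) / 4) := by
  classical
  induction R using Finset.induction_on with
  | empty => simp
  | insert k₀ R hk₀ ih =>
    have hcross : ∑ b : Fin n → Bool, bitDev v k₀ (b k₀) * ∑ k ∈ R, bitDev v k (b k) = 0 := by
      have hinv : Function.Involutive fun b : Fin n → Bool => Function.update b k₀ (!(b k₀)) := by
        intro b
        simp
      have h := Equiv.sum_comp (Function.Involutive.toPerm _ hinv)
        (fun b : Fin n → Bool => bitDev v k₀ (b k₀) * ∑ k ∈ R, bitDev v k (b k))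
      have h' : ∀ b : Fin n → Bool, bitDev v k₀ (Function.Involutive.toPerm _ hinv b k₀) *
          ∑ k ∈ R, bitDev v k (Function.Involutive.toPerm _ hinv b k) =
          -(bitDev v k₀ (b k₀) * ∑ k ∈ R, bitDev v k (b k)) := by
        intro b
        simp only [Function.Involutive.coe_toPerm, Function.update_self, bitDev_not, neg_mul]
        congr 2
        refine Finset.sum_congr rfl fun k hk => ?_
        have : k ≠ k₀ := fun h => hk₀ (h ▸ hk)
        rw [Function.update_of_ne this]
      simp_rw [h'] at h
      rw [Finset.sum_neg_distrib] at h
      linarith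
    have hexp : ∀ b : Fin n → Bool, (∑ k ∈ insert k₀ R, bitDev v k (b k)) ^ 2 =
        (v k₀ : ℝ) ^ 2 / 4 + 2 * (bitDev v k₀ (b k₀) * ∑ k ∈ R, bitDev v k (b k)) +
          (∑ k ∈ R, bitDev v k (b k)) ^ 2 := by
      intro b
      rw [Finset.sum_insert hk₀, ← bitDev_sq v k₀ (b k₀)]
      ring
    simp_rw [hexp]
    rw [Finset.sum_add_distrib, Finset.sum_add_distrib, ← Finset.mul_sum, hcross, ih,
      Finset.sum_insert hk₀]
    simp
    ring

namespace StreamingAlgorithm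

variable (A : StreamingAlgorithm) (φ : Fin n → Bool → ℕ)

theorem measure_bits (G : Set (Fin n → Bool)) :
    (A.bitLaw φ).toMeasure {ω | ω.1 ∈ G} =
      (PMF.uniformOfFintype (Fin n → Bool)).toMeasure G := by
  classical
  have h := A.lintegral_bitLaw_fst φ (G.indicator 1)
  rw [lintegral_indicator_one MeasurableSet.of_discrete] at h
  rw [← h, ← lintegral_indicator_one MeasurableSet.of_discrete]
  rfl

theorem measure_bit (k : Fin n) (a : Bool) :
    (A.bitLaw φ).toMeasure {ω | ω.1 k = a} = 1 / 2 := by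
  have h : 2 * (A.bitLaw φ).toMeasure {ω | ω.1 k = a} = 1 := by
    have h1 := tsum_measure_and_eq (A.bitLaw φ).toMeasure
      (fun ω => ω.2 k.castSucc) (fun ω => ω.1 k = a)
    have h2 := tsum_measure_and_eq (A.bitLaw φ).toMeasure
      (fun ω => ω.2 k.castSucc) (fun _ => True)
    rw [← h1, ← ENNReal.tsum_mul_left]
    simp only [true_and] at h2
    have h3 : ∀ m, 2 * (A.bitLaw φ).toMeasure {ω | ω.1 k = a ∧ ω.2 k.castSucc = m} =
        (A.bitLaw φ).toMeasure {ω | ω.2 k.castSucc = m} := by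
      intro m
      rw [← A.measure_state_and_bit φ k m a]
      simp only [and_comm]
    simp_rw [h3, h2]
    simp
  rw [ENNReal.eq_div_iff (by norm_num) (by norm_num), h]

/-- Chebyshev: the variance is at most `D ^ 2 / 2048`, the squared threshold is `D ^ 2 / 16`, and
the quotient is `1 / 128`. -/
theorem measure_lt_abs_sum_bitDev (v : Fin n → ℕ) (R : Finset (Fin n)) {D : ℕ} (hD : 0 < D)
    (hvar : 512 * ∑ k ∈ R, v k ^ 2 ≤ D ^ 2) :
    (A.bitLaw φ).toMeasure {ω | (D : ℝ) / 4 < |∑ k ∈ R, bitDev v k (ω.1 k)|} ≤ 1 / 128 := by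
  classical
  set G : Finset (Fin n → Bool) :=
    Finset.univ.filter fun b => (D : ℝ) / 4 < |∑ k ∈ R, bitDev v k (b k)| with hG
  have e : {ω : (Fin n → Bool) × (Fin (n + 1) → Mem) |
      (D : ℝ) / 4 < |∑ k ∈ R, bitDev v k (ω.1 k)|} = {ω | ω.1 ∈ (G : Set (Fin n → Bool))} := by
    ext ω; simp [hG]
  rw [e, measure_bits, PMF.toMeasure_uniformOfFintype_apply _ MeasurableSet.of_discrete]
  have hDr : (0 : ℝ) < D := by exact_mod_cast hD
  have hvar' : 512 * ∑ k ∈ R, (v k : ℝ) ^ 2 ≤ (D : ℝ) ^ 2 := by exact_mod_cast hvar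
  have hcount : (G.card : ℝ) * ((D : ℝ) / 4) ^ 2 ≤ 2 ^ n * ((∑ k ∈ R, (v k : ℝ) ^ 2) / 4) := by
    rw [← sum_sq_sum_bitDev, ← nsmul_eq_mul]
    refine (Finset.card_nsmul_le_sum G _ _ fun b hb => ?_).trans
      (Finset.sum_le_sum_of_subset_of_nonneg (Finset.subset_univ G) fun b _ _ => sq_nonneg _)
    rw [← sq_abs (∑ k ∈ R, bitDev v k (b k))]
    have := (Finset.mem_filter.1 hb).2
    gcongr
  have hcard : (G.card : ℝ) * 128 ≤ 2 ^ n := by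
    have h2 : (0 : ℝ) < 2 ^ n := by positivity
    have h3 : (G.card : ℝ) * ((D : ℝ) / 4) ^ 2 ≤ 2 ^ n * ((D : ℝ) ^ 2 / 512 / 4) := by
      refine hcount.trans ?_
      gcongr
      linarith
    have h4 : (0 : ℝ) < (D : ℝ) ^ 2 := by positivity
    have h5 : ((G.card : ℝ) * 128) * (D : ℝ) ^ 2 ≤ 2 ^ n * (D : ℝ) ^ 2 := by nlinarith
    exact le_of_mul_le_mul_right h5 h4
  have hcard' : G.card * 128 ≤ 2 ^ n := by exact_mod_cast hcard
  simp only [Fintype.card_fun, Fintype.card_bool, Fintype.card_fin, Fintype.card_coe,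
    Finset.coe_sort_coe]
  refine ENNReal.div_le_of_le_mul ?_
  have hcard2 : (G.card : ℝ≥0∞) * 128 ≤ 2 ^ n := by exact_mod_cast hcard'
  calc (G.card : ℝ≥0∞) = 1 / 128 * (G.card * 128) := by
        rw [one_div, mul_comm, mul_assoc, ENNReal.mul_inv_cancel (by norm_num) (by norm_num),
          mul_one]
    _ ≤ 1 / 128 * 2 ^ n := by gcongr
    _ = _ := by push_cast; rfl

/-- Given the state before input `j` and the state after input `i`, the bits lie in `G` and the
`j`-th bit has either of its values with conditional probability at least `1 / 8`. -/
def GoodPair (j i : Fin n) (G : Set (Fin n → Bool)) (m m' : Mem) : Prop :=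
  ∀ a : Bool, 8⁻¹ * (A.bitLaw φ).toMeasure {ω | ω.2 j.castSucc = m ∧ ω.2 i.succ = m'} ≤
    (A.bitLaw φ).toMeasure {ω | (ω.2 j.castSucc = m ∧ ω.2 i.succ = m') ∧ ω.1 ∈ {b | b j = a ∧ b ∈ G}}

/-- Suppose the value `a` fails on a fibre of end states. Either `G` fails there with conditional
probability at least `1/8`, or bit `j` equals `a` with conditional probability below `1/4`. In the
latter case the opposite value has at least `3/4 = (3/2)(1/2)`, and the bit is fair given the
earlier state alone, so at least `3/4` of the fibre lies in the correlation event. -/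
theorem measure_not_goodPair_le (j i : Fin n) (hφ : Function.Injective (φ j))
    (G : Set (Fin n → Bool)) :
    (A.bitLaw φ).toMeasure {ω | ¬ A.GoodPair φ j i G (ω.2 j.castSucc) (ω.2 i.succ)} ≤
      4 / 3 * A.corrProb φ i j + 8 * (A.bitLaw φ).toMeasure {ω | ω.1 ∉ G} := by
  classical
  set μ := (A.bitLaw φ).toMeasure with hμ
  set Z : (Fin n → Bool) × (Fin (n + 1) → Mem) → Mem × Mem :=
    fun ω => (ω.2 j.castSucc, ω.2 i.succ) with hZ
  rw [corrProb, ← tsum_measure_inter_fiber μ Z, ← tsum_measure_inter_fiber μ Z,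
    ← tsum_measure_inter_fiber μ Z {ω | ω.1 ∉ G}, ← ENNReal.tsum_mul_left, ← ENNReal.tsum_mul_left,
    ← ENNReal.tsum_add]
  refine ENNReal.tsum_le_tsum fun z => ?_
  obtain ⟨m, m'⟩ := z
  by_cases hg : A.GoodPair φ j i G m m'
  · refine le_trans (le_of_eq (measure_mono_null (t := ∅) ?_ measure_empty)) zero_le
    rintro ω ⟨h1, h2⟩
    simp only [hZ, Set.mem_preimage, Set.mem_singleton_iff, Prod.mk.injEq] at h2
    simp only [Set.mem_ofPred_eq, h2] at h1
    exact h1 hg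
  set C := Z ⁻¹' {(m, m')} with hC
  have hCe : C = {ω | ω.2 j.castSucc = m ∧ ω.2 i.succ = m'} := by
    ext ω; simp [hC, hZ]
  refine (measure_mono Set.inter_subset_right).trans ?_
  simp only [GoodPair, not_forall, not_le] at hg
  obtain ⟨a, ha⟩ := hg
  rw [← hCe, ← hμ] at ha
  have hS : μ (C ∩ {ω | ω.1 j = a}) ≤ μ {ω | (ω.2 j.castSucc = m ∧ ω.2 i.succ = m') ∧
      ω.1 ∈ {b | b j = a ∧ b ∈ G}} + μ ({ω | ω.1 ∉ G} ∩ C) := by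
    refine (measure_mono ?_).trans (measure_union_le _ _)
    rintro ω ⟨h1, h2⟩
    by_cases h : ω.1 ∈ G
    · left
      rw [hCe] at h1
      exact ⟨h1, h2, h⟩
    · exact Or.inr ⟨h, h1⟩
  have hsplit : μ C = μ (C ∩ {ω | ω.1 j = a}) + μ (C ∩ {ω | ω.1 j = !a}) := by
    rw [← measure_inter_add_sdiff C (t := {ω | ω.1 j = a}) MeasurableSet.of_discrete]
    congr 2
    ext ω
    cases a <;> simp
  have hsub : 3 / 4 * μ C ≤ μ (C ∩ {ω | ω.1 j = !a}) → C ∩ {ω | ω.1 j = !a} ⊆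
      corrSet μ (fun ω => ω.2 i.succ) (fun ω => φ j (ω.1 j)) (fun ω => ω.2 j.castSucc) ∩ C := by
    rintro h ω ⟨h1, h2⟩
    refine ⟨?_, h1⟩
    rw [hCe] at h1
    obtain ⟨hm, hm'⟩ := h1
    simp only [Set.mem_ofPred_eq] at h2
    simp only [corrSet, Set.mem_ofPred_eq, hm, hm', h2, hφ.eq_iff]
    have e1 : {ω' : (Fin n → Bool) × (Fin (n + 1) → Mem) | ω'.2 j.castSucc = m ∧
        ω'.1 j = (!a) ∧ ω'.2 i.succ = m'} = C ∩ {ω | ω.1 j = !a} := by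
      rw [hCe]; ext ω; simp only [Set.mem_ofPred_eq, Set.mem_inter_iff]; tauto
    rw [e1, ← hCe, ← A.measure_state_and_bit φ j m (!a), ← hμ]
    set p := μ {ω | ω.2 j.castSucc = m ∧ ω.1 j = !a}
    calc 3 * (p * μ C) = 4 * p * (3 / 4 * μ C) := by
          rw [← mul_assoc (4 * p), mul_right_comm 4 p, ENNReal.mul_div_cancel (by norm_num)
            (by norm_num)]
          ring
      _ ≤ 4 * p * μ (C ∩ {ω | ω.1 j = !a}) := by gcongr
      _ = _ := by ring
  by_cases hG : 8⁻¹ * μ C ≤ μ ({ω | ω.1 ∉ G} ∩ C)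
  · refine le_trans ?_ le_add_self
    calc μ C = 8 * (8⁻¹ * μ C) := by
          rw [← mul_assoc, ENNReal.mul_inv_cancel (by norm_num) (by norm_num), one_mul]
      _ ≤ _ := by gcongr
  · rw [not_le] at hG
    refine le_trans ?_ le_self_add
    have hlt : μ (C ∩ {ω | ω.1 j = a}) ≤ 1 / 4 * μ C := by
      refine hS.trans ((add_le_add ha.le hG.le).trans (le_of_eq ?_))
      rw [← add_mul]
      congr 1
      rw [← ENNReal.toReal_eq_toReal_iff' (by finiteness) (by finiteness),
        ENNReal.toReal_add (by finiteness) (by finiteness)]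
      norm_num
    have hge : 3 / 4 * μ C ≤ μ (C ∩ {ω | ω.1 j = !a}) := by
      have hCt : μ C ≠ ∞ := measure_ne_top _ _
      have h4 : 1 / 4 * μ C ≠ ∞ := by finiteness
      refine (ENNReal.add_le_add_iff_left h4).1 ?_
      calc 1 / 4 * μ C + 3 / 4 * μ C = μ C := by
            rw [← add_mul, ENNReal.div_add_div_same]
            norm_num
            rw [ENNReal.div_self (by norm_num) (by norm_num), one_mul]
        _ = _ := hsplit
        _ ≤ _ := by gcongr
    calc μ C = 4 / 3 * (3 / 4 * μ C) := by
          rw [← mul_assoc]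
          have : (4 / 3 : ℝ≥0∞) * (3 / 4) = 1 := by
            rw [← ENNReal.toReal_eq_toReal_iff' (by finiteness) (by finiteness)]
            simp
          rw [this, one_mul]
      _ ≤ 4 / 3 * μ (C ∩ {ω | ω.1 j = !a}) := by gcongr
      _ ≤ _ := by
          exact mul_le_mul_right (measure_mono (hsub hge)) _

/-- The guarantee for fixed inputs, averaged over the bits. The `if` discards count zero, for which
nothing is guaranteed. -/
theorem lintegral_failure_le {ε δ : ℝ} {N : ℕ} (hA : A.IsApproxCounterUpTo ε δ N)
    (hφ : ∀ b : Fin n → Bool, ∑ k, φ k (b k) ≤ N) :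
    ∫⁻ ω, (if 1 ≤ ∑ k, φ k (ω.1 k) then (A.query n (ω.2 (Fin.last n)) : Measure ℝ)
      {y : ℝ | ε * ((∑ k, φ k (ω.1 k) : ℕ) : ℝ) ≤ |y - ((∑ k, φ k (ω.1 k) : ℕ) : ℝ)|} else 0)
      ∂(A.bitLaw φ).toMeasure ≤ ENNReal.ofReal δ := by
  rw [lintegral_bitLaw_eq_sum]
  calc _ ≤ ∑ b : Fin n → Bool, PMF.uniformOfFintype (Fin n → Bool) b * ENNReal.ofReal δ := by
        refine Finset.sum_le_sum fun b _ => ?_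
        gcongr
        by_cases h : 1 ≤ ∑ k, φ k (b k)
        · simp only [h, if_true]
          exact hA n (fun k => φ k (b k)) h (hφ b)
        · simp [h]
    _ = ENNReal.ofReal δ := by
        rw [← Finset.sum_mul, ← tsum_fintype (L := .unconditional _), PMF.tsum_coe, one_mul]

end StreamingAlgorithm

end ApproxCounting

/-! ### The failure argument for one family of disjoint windows. -/

namespace ApproxCounting

variable {n : ℕ}

theorem splice_snd_of_notMem {I : Set (Fin n)} {J : Set (Fin (n + 1))}
    (ω ω' : (Fin n → Bool) × (Fin (n + 1) → Mem)) {k : Fin (n + 1)} (hk : k ∉ J) :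
    (splice I J ω ω').2 k = ω.2 k := by
  simp only [splice, if_neg hk]

theorem splice_fst_of_notMem {I : Set (Fin n)} {J : Set (Fin (n + 1))}
    (ω ω' : (Fin n → Bool) × (Fin (n + 1) → Mem)) {k : Fin n} (hk : k ∉ I) :
    (splice I J ω ω').1 k = ω.1 k := by
  simp only [splice, if_neg hk]

theorem sum_bitInput_sub_sum_bitDev_congr (v : Fin n → ℕ) (R : Finset (Fin n))
    {b b' : Fin n → Bool} (h : ∀ k ∉ R, b k = b' k) :
    ((∑ k, bitInput v k (b k) : ℕ) : ℝ) - ∑ k ∈ R, bitDev v k (b k) =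
      ((∑ k, bitInput v k (b' k) : ℕ) : ℝ) - ∑ k ∈ R, bitDev v k (b' k) := by
  classical
  have key : ∀ b : Fin n → Bool,
      ((∑ k, bitInput v k (b k) : ℕ) : ℝ) - ∑ k ∈ R, bitDev v k (b k) =
      ∑ k ∈ Rᶜ, (bitInput v k (b k) : ℝ) + ∑ k ∈ R, (v k : ℝ) / 2 := by
    intro b
    push_cast
    rw [← Finset.sum_add_sum_compl R]
    have : ∀ k, (bitInput v k (b k) : ℝ) = bitDev v k (b k) + (v k : ℝ) / 2 := by
      intro k
      cases b k <;> simp [bitInput, bitDev]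
    rw [Finset.sum_congr rfl fun k (_ : k ∈ R) => this k, Finset.sum_add_distrib]
    ring
  rw [key, key]
  congr 1
  refine Finset.sum_congr rfl fun k hk => ?_
  rw [h k (Finset.mem_compl.1 hk)]

theorem bitInput_injective {v : Fin n → ℕ} {k : Fin n} (h : 0 < v k) :
    Function.Injective (bitInput v k) := by
  intro a b hab
  cases a <;> cases b <;> simp [bitInput] at hab ⊢ <;> omega

/-- If few of the pairs of states at the ends of disjoint windows are good, then the state at the
end of a window is often correlated with the first input of the window. -/
theorem StreamingAlgorithm.measure_few_bad_ge (A : StreamingAlgorithm) (v : Fin n → ℕ)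
    {ι : Type*} (Q : Finset ι) (j i : ι → Fin n) {D : ℕ} (hD : 0 < D)
    (hvj : ∀ q ∈ Q, v (j q) = D)
    (hvar : ∀ q ∈ Q, 512 * ∑ k ∈ (Finset.Icc (j q) (i q)).erase (j q), v k ^ 2 ≤ D ^ 2)
    (k₀ : Fin n) (G : ι → Set (Fin n → Bool))
    (hG : ∀ q, G q =
      {b | |∑ k ∈ (Finset.Icc (j q) (i q)).erase (j q), bitDev v k (b k)| ≤ (D : ℝ) / 4})
    (hQ : 0 < Q.card)
    (hcorr : ∑ q ∈ Q, A.corrProb (bitInput v) (i q) (j q) ≤ 3 / 64 * Q.card)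
    [∀ ω : (Fin n → Bool) × (Fin (n + 1) → Mem), DecidablePred fun q =>
      ¬ A.GoodPair (bitInput v) (j q) (i q) (G q) (ω.2 (j q).castSucc) (ω.2 (i q).succ)] :
    1 / 4 ≤ (A.bitLaw (bitInput v)).toMeasure {ω | 2 * (Q.filter fun q =>
      ¬ A.GoodPair (bitInput v) (j q) (i q) (G q) (ω.2 (j q).castSucc) (ω.2 (i q).succ)).card <
        Q.card ∧ ω.1 k₀ = true} := by
  set μ := (A.bitLaw (bitInput v)).toMeasure with hμ
  set B : (Fin n → Bool) × (Fin (n + 1) → Mem) → ℕ := fun ω => (Q.filter fun q =>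
      ¬ A.GoodPair (bitInput v) (j q) (i q) (G q) (ω.2 (j q).castSucc) (ω.2 (i q).succ)).card
    with hB
  -- The expected number of bad windows: `(4/3)(3/64) + 8/128 = 1/16 + 1/16 = 1/8` per window.
  have hint : ∫⁻ ω, (B ω : ℝ≥0∞) ∂μ ≤ 1 / 8 * Q.card := by
    have h1 : ∀ ω, (B ω : ℝ≥0∞) = ∑ q ∈ Q, Set.indicator {ω | ¬ A.GoodPair (bitInput v) (j q) (i q)
        (G q) (ω.2 (j q).castSucc) (ω.2 (i q).succ)} 1 ω := by
      intro ω
      simp only [hB, Finset.card_filter, Nat.cast_sum, Set.indicator_apply, Set.mem_ofPred_eq]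
      refine Finset.sum_congr rfl fun q _ => ?_
      split_ifs <;> simp
    simp_rw [h1]
    rw [lintegral_finsetSum _ (fun _ _ => Measurable.of_discrete)]
    simp_rw [lintegral_indicator_one MeasurableSet.of_discrete]
    calc _ ≤ ∑ q ∈ Q, (4 / 3 * A.corrProb (bitInput v) (i q) (j q) + 8 * (1 / 128)) := by
          refine Finset.sum_le_sum fun q hq => (A.measure_not_goodPair_le (bitInput v) (j q) (i q)
            (bitInput_injective (by rw [hvj q hq]; exact hD)) (G q)).trans ?_
          gcongr
          refine le_trans (le_of_eq ?_) (A.measure_lt_abs_sum_bitDev (bitInput v) v _ hD (hvar q hq))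
          simp [hG]
      _ = 4 / 3 * ∑ q ∈ Q, A.corrProb (bitInput v) (i q) (j q) + Q.card * (8 * (1 / 128)) := by
          rw [Finset.sum_add_distrib, ← Finset.mul_sum]
          simp
      _ ≤ 4 / 3 * (3 / 64 * Q.card) + Q.card * (8 * (1 / 128)) := by gcongr
      _ = 1 / 8 * Q.card := by
          rw [← ENNReal.toReal_eq_toReal_iff' (by finiteness) (by finiteness),
            ENNReal.toReal_add (by finiteness) (by finiteness)]
          simp
          ring
  have hmarkov : μ {ω | Q.card ≤ 2 * B ω} ≤ 1 / 4 := by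
    have h2 := mul_meas_ge_le_lintegral₀ (μ := μ) (f := fun ω => 2 * (B ω : ℝ≥0∞))
      Measurable.of_discrete.aemeasurable (Q.card : ℝ≥0∞)
    rw [lintegral_const_mul _ Measurable.of_discrete] at h2
    have hQ0 : (Q.card : ℝ≥0∞) ≠ 0 := by exact_mod_cast hQ.ne'
    have h3 : (Q.card : ℝ≥0∞) * μ {ω | Q.card ≤ 2 * B ω} ≤ Q.card * (1 / 4) := by
      calc _ ≤ (Q.card : ℝ≥0∞) * μ {ω | (Q.card : ℝ≥0∞) ≤ 2 * (B ω : ℝ≥0∞)} := by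
            refine mul_le_mul_right (measure_mono fun ω hω => ?_) _
            simp only [Set.mem_ofPred_eq] at hω ⊢
            exact_mod_cast hω
        _ ≤ 2 * (1 / 8 * Q.card) := h2.trans (by gcongr)
        _ = _ := by
            rw [← ENNReal.toReal_eq_toReal_iff' (by finiteness) (by finiteness)]
            simp
            ring
    exact (ENNReal.mul_le_mul_iff_right hQ0 (ENNReal.natCast_ne_top _)).1 h3
  -- Markov's inequality leaves at most `1/4` for having half of the windows bad, and bit `k₀` is
  -- unset with probability `1/2`.
  have hcover : 1 ≤ μ {ω | 2 * B ω < Q.card ∧ ω.1 k₀ = true} +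
      (μ {ω | Q.card ≤ 2 * B ω} + μ {ω | ω.1 k₀ = false}) := by
    calc (1 : ℝ≥0∞) = μ Set.univ := measure_univ.symm
      _ ≤ μ ({ω | 2 * B ω < Q.card ∧ ω.1 k₀ = true} ∪
          ({ω | Q.card ≤ 2 * B ω} ∪ {ω | ω.1 k₀ = false})) := by
        refine measure_mono fun ω _ => ?_
        by_cases h1 : Q.card ≤ 2 * B ω
        · exact Or.inr (Or.inl h1)
        · cases h2 : ω.1 k₀
          · exact Or.inr (Or.inr h2)
          · exact Or.inl ⟨not_le.1 h1, h2⟩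
      _ ≤ _ := (measure_union_le _ _).trans (add_le_add_right (measure_union_le _ _) _)
  rw [A.measure_bit] at hcover
  have h34 : 1 / 4 + 1 / 2 ≠ (∞ : ℝ≥0∞) := by finiteness
  refine (ENNReal.add_le_add_iff_right h34).1 (le_trans (le_of_eq ?_)
    (hcover.trans (add_le_add_right (add_le_add_left hmarkov _) _)))
  rw [← ENNReal.toReal_eq_toReal_iff' (by finiteness) (by finiteness),
    ENNReal.toReal_add (by finiteness) (by finiteness),
    ENNReal.toReal_add (by finiteness) (by finiteness)]
  norm_num

/-- If the correlations were smaller, most windows would often be good, and the count could be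
pushed away from the answer on either side without changing the law of the query, with probability
too large for `δ`. -/
theorem StreamingAlgorithm.le_sum_corrProb (A : StreamingAlgorithm) (v : Fin n → ℕ) {ε δ : ℝ}
    {N : ℕ} (hA : A.IsApproxCounterUpTo ε δ N) (hv : ∑ k, v k ≤ N)
    {ι : Type*} (Q : Finset ι) (j i : ι → Fin n) (hji : ∀ q ∈ Q, j q ≤ i q)
    (hdisj : ∀ q ∈ Q, ∀ q' ∈ Q, q ≠ q' → i q < j q' ∨ i q' < j q)
    {D : ℕ} (hD : 0 < D) (hvj : ∀ q ∈ Q, v (j q) = D)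
    (hvar : ∀ q ∈ Q, 512 * ∑ k ∈ (Finset.Icc (j q) (i q)).erase (j q), v k ^ 2 ≤ D ^ 2)
    {k₀ : Fin n} (hk₀ : ∀ q ∈ Q, k₀ ∉ Finset.Icc (j q) (i q)) (hv₀ : 0 < v k₀)
    (hε : 0 ≤ ε) (hgap : ε * N ≤ Q.card * D / 8) (hδ : 8 ^ (Q.card + 1) * δ < 1) :
    3 / 64 * Q.card ≤ ∑ q ∈ Q, A.corrProb (bitInput v) (i q) (j q) := by
  classical
  by_contra! hcorr
  have hQ : 0 < Q.card := by
    rcases Nat.eq_zero_or_pos Q.card with h | h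
    · simp [h] at hcorr
    · exact h
  set φ := bitInput v with hφ
  set μ := (A.bitLaw φ).toMeasure with hμ
  set G : ι → Set (Fin n → Bool) := fun q =>
    {b | |∑ k ∈ (Finset.Icc (j q) (i q)).erase (j q), bitDev v k (b k)| ≤ (D : ℝ) / 4} with hG
  set Gd : ι → Mem → Mem → Prop := fun q => A.GoodPair φ (j q) (i q) (G q) with hGd
  set dev : ι → (Fin n → Bool) → ℝ := fun q b => ∑ k ∈ Finset.Icc (j q) (i q), bitDev v k (b k)
    with hdev
  set H : Set ((Fin n → Bool) × (Fin (n + 1) → Mem)) := {ω | 2 * (Q.filter fun q =>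
      ¬ Gd q (ω.2 (j q).castSucc) (ω.2 (i q).succ)).card < Q.card ∧ ω.1 k₀ = true} with hH
  have hμH : 1 / 4 ≤ μ H := A.measure_few_bad_ge v Q j i hD hvj hvar k₀ G (fun _ => rfl) hQ hcorr.le
  set cnt : (Fin n → Bool) → ℕ := fun b => ∑ k, φ k (b k) with hcnt
  -- The count with the contribution of each good window replaced by its mean: a reference value
  -- that resampling a good window cannot alter.
  set V : (Fin n → Bool) × (Fin (n + 1) → Mem) → ℝ := fun ω => (cnt ω.1 : ℝ) -
    ∑ q ∈ Q, if Gd q (ω.2 (j q).castSucc) (ω.2 (i q).succ) then dev q ω.1 else 0 with hV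
  have hcntle : ∀ b, cnt b ≤ N := fun b => by
    refine le_trans (Finset.sum_le_sum fun k _ => ?_) hv
    simp only [hφ, bitInput]
    split_ifs <;> simp
  -- the quantities below are unchanged when the inside of a good window is resampled
  have hinv : ∀ q₀ ∈ Q, ∀ ω ω', Gd q₀ (ω.2 (j q₀).castSucc) (ω.2 (i q₀).succ) →
      let σ := splice (Set.Icc (j q₀) (i q₀)) (interiorStates (j q₀) (i q₀)) ω ω'
      (σ ∈ H ↔ ω ∈ H) ∧ V σ = V ω ∧ σ.2 (Fin.last n) = ω.2 (Fin.last n) := by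
    intro q₀ hq₀ ω ω' hgood σ
    have hb : ∀ q ∈ Q, σ.2 (j q).castSucc = ω.2 (j q).castSucc ∧
        σ.2 (i q).succ = ω.2 (i q).succ := by
      intro q hq
      have hq1 := Fin.le_def.1 (hji q hq)
      have hq2 := Fin.le_def.1 (hji q₀ hq₀)
      refine ⟨splice_snd_of_notMem _ _ ?_, splice_snd_of_notMem _ _ ?_⟩ <;>
      · simp only [interiorStates, Set.mem_ofPred_eq, Fin.val_castSucc, Fin.val_succ]
        by_cases hne : q = q₀
        · subst hne; omega
        · have hd := hdisj q hq q₀ hq₀ hne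
          rw [Fin.lt_def, Fin.lt_def] at hd
          omega
    have hgd : ∀ q ∈ Q, (Gd q (σ.2 (j q).castSucc) (σ.2 (i q).succ) ↔
        Gd q (ω.2 (j q).castSucc) (ω.2 (i q).succ)) := by
      intro q hq
      rw [(hb q hq).1, (hb q hq).2]
    refine ⟨?_, ?_, ?_⟩
    · have e : (Q.filter fun q => ¬ Gd q (σ.2 (j q).castSucc) (σ.2 (i q).succ)) =
          (Q.filter fun q => ¬ Gd q (ω.2 (j q).castSucc) (ω.2 (i q).succ)) :=
        Finset.filter_congr fun q hq => not_congr (hgd q hq)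
      have e0 : σ.1 k₀ = ω.1 k₀ :=
        splice_fst_of_notMem _ _ (fun h => hk₀ q₀ hq₀ (by simpa using h))
      simp only [hH, Set.mem_ofPred_eq, e, e0]
    · simp only [hV]
      rw [← Finset.add_sum_erase Q _ hq₀, ← Finset.add_sum_erase Q (fun q =>
        if Gd q (ω.2 (j q).castSucc) (ω.2 (i q).succ) then dev q ω.1 else 0) hq₀,
        if_pos ((hgd q₀ hq₀).2 hgood), if_pos hgood, ← sub_sub, ← sub_sub]
      congr 1
      · refine sum_bitInput_sub_sum_bitDev_congr v _ fun k hk => ?_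
        exact splice_fst_of_notMem _ _ (fun h => hk (by simpa using h))
      · refine Finset.sum_congr rfl fun q hq => ?_
        obtain ⟨hne, hq⟩ := Finset.mem_erase.1 hq
        refine if_congr (hgd q hq) ?_ rfl
        refine Finset.sum_congr rfl fun k hk => ?_
        rw [splice_fst_of_notMem]
        have hd := hdisj q hq q₀ hq₀ hne
        rw [Fin.lt_def, Fin.lt_def] at hd
        simp only [Finset.mem_Icc, Fin.le_def] at hk
        simp only [Set.mem_Icc, Fin.le_def]
        omega
    · refine splice_snd_of_notMem _ _ ?_
      simp only [interiorStates, Set.mem_ofPred_eq, Fin.val_last]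
      omega
  -- A good window with first bit `a` deviates in direction `a` by at least `D/2 - D/4`. On `H` at
  -- least half of the windows are good, so the total is at least `|Q| D / 8`, which dominates `ε
  -- N`.
  have hdevE : ∀ (a : Bool) (ω : (Fin n → Bool) × (Fin (n + 1) → Mem)), ω ∈ H →
      (∀ q ∈ Q, Gd q (ω.2 (j q).castSucc) (ω.2 (i q).succ) → ω.1 ∈ {b | b (j q) = a ∧ b ∈ G q}) →
      ε * cnt ω.1 ≤ (if a = true then (cnt ω.1 : ℝ) - V ω else V ω - cnt ω.1) := by
    intro a ω hω hE
    have hDr : (0 : ℝ) < D := by exact_mod_cast hD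
    set s : ℝ := if a = true then 1 else -1 with hs
    have h1 : ∀ q ∈ Q, Gd q (ω.2 (j q).castSucc) (ω.2 (i q).succ) →
        (D : ℝ) / 4 ≤ s * dev q ω.1 := by
      intro q hq hg
      obtain ⟨ha, hr⟩ := hE q hq hg
      simp only [hG, Set.mem_ofPred_eq] at hr
      simp only [hdev]
      rw [← Finset.add_sum_erase _ _ (Finset.mem_Icc.2 ⟨le_rfl, hji q hq⟩), ha]
      rw [abs_le] at hr
      cases a <;> simp [bitDev, hvj q hq, hs] at hr ⊢ <;> linarith
    have h2 : ((Q.filter fun q => Gd q (ω.2 (j q).castSucc) (ω.2 (i q).succ)).card : ℝ) *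
        ((D : ℝ) / 4) ≤ s * ((cnt ω.1 : ℝ) - V ω) := by
      simp only [hV, sub_sub_cancel]
      rw [← Finset.sum_filter, Finset.mul_sum, ← nsmul_eq_mul]
      refine Finset.card_nsmul_le_sum _ _ _ fun q hq => ?_
      obtain ⟨hq, hg⟩ := Finset.mem_filter.1 hq
      exact h1 q hq hg
    have h3 : (Q.card : ℝ) / 2 ≤
        (Q.filter fun q => Gd q (ω.2 (j q).castSucc) (ω.2 (i q).succ)).card := by
      have h4 := Finset.card_filter_add_card_filter_not (s := Q)
        (fun q => Gd q (ω.2 (j q).castSucc) (ω.2 (i q).succ))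
      have h5 := hω.1
      have h6 : Q.card ≤
        2 * (Q.filter fun q => Gd q (ω.2 (j q).castSucc) (ω.2 (i q).succ)).card := by omega
      have h7 : (Q.card : ℝ) ≤
        2 * (Q.filter fun q => Gd q (ω.2 (j q).castSucc) (ω.2 (i q).succ)).card := by
        exact_mod_cast h6
      linarith
    have h8 : (Q.card : ℝ) * D / 8 ≤ s * ((cnt ω.1 : ℝ) - V ω) := by
      refine le_trans ?_ h2
      calc (Q.card : ℝ) * D / 8 = Q.card / 2 * (D / 4) := by ring
        _ ≤ _ := by gcongr
    have h9 : ε * cnt ω.1 ≤ ε * N := by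
      have : (cnt ω.1 : ℝ) ≤ N := by exact_mod_cast hcntle ω.1
      gcongr
    refine h9.trans (hgap.trans (h8.trans (le_of_eq ?_)))
    cases a <;> simp [hs]
  set fail : (Fin n → Bool) × (Fin (n + 1) → Mem) → ℝ≥0∞ := fun ω =>
    if 1 ≤ cnt ω.1 then (A.query n (ω.2 (Fin.last n)) : Measure ℝ)
      {y : ℝ | ε * (cnt ω.1 : ℝ) ≤ |y - (cnt ω.1 : ℝ)|} else 0 with hfail
  have hfailint : ∫⁻ ω, fail ω ∂μ ≤ ENNReal.ofReal δ := A.lintegral_failure_le φ hA hcntle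
  -- The bit `k₀` lies outside all windows and keeps the count positive, so the guarantee applies
  -- after resampling too.
  have hpos : ∀ ω ∈ H, 1 ≤ cnt ω.1 := by
    intro ω hω
    refine le_trans ?_ (Finset.single_le_sum (f := fun k => φ k (ω.1 k)) (fun _ _ => Nat.zero_le _)
      (Finset.mem_univ k₀))
    simp only [hφ, bitInput, hω.2, if_true]
    exact hv₀
  -- Answers below `V` are paired with pushing the count up, the others with pushing it down; both
  -- lead to failures, and the two cases exhaust `H`.
  set F : Bool → (Fin n → Bool) × (Fin (n + 1) → Mem) → ℝ≥0∞ := fun a ω =>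
    if ω ∈ H then (A.query n (ω.2 (Fin.last n)) : Measure ℝ)
      (if a = true then Set.Iio (V ω) else Set.Ici (V ω)) else 0 with hF
  have hmain : ∀ a : Bool, 8⁻¹ ^ Q.card * ∫⁻ ω, F a ω ∂μ ≤ ENNReal.ofReal δ := by
    intro a
    refine (pow_mul_lintegral_le_of_windows A φ Q j i hji hdisj (F a)
      (fun q => {b | b (j q) = a ∧ b ∈ G q}) Gd (ENNReal.inv_le_one.2 (by norm_num)) ?_ ?_ ?_).trans
      ((lintegral_mono fun ω => ?_).trans hfailint)
    · intro q hq ω ω' _ _ hg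
      obtain ⟨h1, h2, h3⟩ := hinv q hq ω ω' hg
      simp only [hF, h1, h2, h3]
    · intro q hq b b' h
      have e : ∀ k ∈ Finset.Icc (j q) (i q), b k = b' k := fun k hk => h k (by simpa using hk)
      have e1 := e (j q) (Finset.mem_Icc.2 ⟨le_rfl, hji q hq⟩)
      have e2 : ∑ k ∈ (Finset.Icc (j q) (i q)).erase (j q), bitDev v k (b k) =
          ∑ k ∈ (Finset.Icc (j q) (i q)).erase (j q), bitDev v k (b' k) :=
        Finset.sum_congr rfl fun k hk => by rw [e k (Finset.mem_of_mem_erase hk)]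
      simp only [hG, Set.mem_ofPred_eq, e1, e2]
    · intro q _ m m' hg
      exact hg a
    · by_cases hω : ω ∈ H
      swap
      · simp [hF, hω]
      split_ifs with hE
      swap
      · simp
      simp only [hF, hfail, if_pos hω, if_pos (hpos ω hω), mul_one]
      refine measure_mono fun y hy => ?_
      have := hdevE a ω hω hE
      simp only [Set.mem_ofPred_eq]
      refine this.trans ?_
      cases a
      · simp only [Bool.false_eq_true, if_false, Set.mem_Ici] at hy ⊢
        exact le_trans (by linarith) (le_abs_self _)
      · simp only [if_true, Set.mem_Iio] at hy ⊢
        exact le_trans (by linarith) (neg_le_abs _)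
  have hsum : ∫⁻ ω, F true ω ∂μ + ∫⁻ ω, F false ω ∂μ = μ H := by
    rw [← lintegral_add_left Measurable.of_discrete, ← lintegral_indicator_one
      MeasurableSet.of_discrete]
    refine lintegral_congr fun ω => ?_
    by_cases hω : ω ∈ H
    · simp only [hF, if_pos hω, if_true, Bool.false_eq_true, if_false, Set.indicator_of_mem hω,
        Pi.one_apply]
      rw [← measure_union _ measurableSet_Ici, Set.Iio_union_Ici, measure_univ]
      exact Set.disjoint_left.2 fun y h1 h2 => not_lt.2 (Set.mem_Ici.1 h2) (Set.mem_Iio.1 h1)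
    · simp [hF, hω]
  -- Clearing denominators gives `1 ≤ 8 ^ (|Q| + 1) δ`, the extra `8` being `4 * 2`; this
  -- contradicts `hδ`.
  have hfin : 8⁻¹ ^ Q.card * (1 / 4) ≤ 2 * ENNReal.ofReal δ := by
    calc _ ≤ 8⁻¹ ^ Q.card * μ H := by gcongr
      _ = 8⁻¹ ^ Q.card * ∫⁻ ω, F true ω ∂μ + 8⁻¹ ^ Q.card * ∫⁻ ω, F false ω ∂μ := by
        rw [← hsum, mul_add]
      _ ≤ _ := by
        rw [two_mul]
        exact add_le_add (hmain true) (hmain false)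
  have h8 : (8 : ℝ≥0∞)⁻¹ ^ Q.card * (1 / 4) = ENNReal.ofReal (8⁻¹ ^ Q.card * (1 / 4)) := by
    rw [ENNReal.ofReal_mul (by positivity), ENNReal.ofReal_pow (by norm_num),
      ENNReal.ofReal_inv_of_pos (by norm_num), ENNReal.ofReal_div_of_pos (by norm_num)]
    simp
  have h2 : 2 * ENNReal.ofReal δ = ENNReal.ofReal (2 * δ) := by
    rw [ENNReal.ofReal_mul (by norm_num)]
    simp
  rw [h8, h2] at hfin
  have hδ0 : 0 < δ := by
    by_contra hneg
    rw [ENNReal.ofReal_of_nonpos (p := 2 * δ) (by linarith)] at hfin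
    have := ENNReal.ofReal_pos.2 (show (0 : ℝ) < 8⁻¹ ^ Q.card * (1 / 4) by positivity)
    exact absurd hfin (not_le.2 this)
  rw [ENNReal.ofReal_le_ofReal_iff (by positivity)] at hfin
  have h9 : (8 : ℝ) ^ Q.card * (8⁻¹ ^ Q.card * (1 / 4)) ≤ 8 ^ Q.card * (2 * δ) := by gcongr
  rw [← mul_assoc, ← mul_pow] at h9
  norm_num at h9
  rw [pow_succ] at hδ
  linarith

end ApproxCounting

/-! ### Arithmetic of the interleaved sequence and its windows. -/

namespace ApproxCounting

/-- The largest value of the entry at position `k` of the interleaved sequence. -/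
def scaleValue (B L k : ℕ) : ℕ := if B ^ (k % L + 1) ∣ k / L then B ^ (k % L + 1) else 0

theorem interleavedDist_eq_map (B L : ℕ) :
    interleavedDist B L = (PMF.uniformOfFintype (Fin (B ^ L * L) → Bool)).map fun b k =>
      bitInput (fun k : Fin (B ^ L * L) => scaleValue B L k) k (b k) := by
  rw [interleavedDist]
  congr 1
  funext b k
  simp only [bitInput, scaleValue]
  split_ifs <;> simp_all

theorem card_filter_dvd_Ico {d : ℕ} (hd : 0 < d) (u c : ℕ) :
    ((Finset.Ico u (u + d * c)).filter fun t => d ∣ t).card = c := by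
  rw [Nat.filter_Ico_card_eq_of_periodic]
  · rw [Nat.count_eq_card_filter_range]
    have h := Nat.count_modEq_card (d * c) hd 0
    rw [Nat.count_eq_card_filter_range] at h
    simp only [Nat.modEq_zero_iff_dvd] at h
    rw [h]
    simp [hd]
  · intro t
    simp [Nat.dvd_add_left (Dvd.intro c rfl)]

/-- Each of the `L` scales contributes `B ^ L`: a nonzero entry `B ^ (m + 1)` occurs once in every
`B ^ (m + 1)` times. -/
theorem sum_scaleValue_le {B : ℕ} (hB : 0 < B) (L : ℕ) :
    ∑ k : Fin (B ^ L * L), scaleValue B L k ≤ B ^ L * L := by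
  rw [← Equiv.sum_comp finProdFinEquiv, Fintype.sum_prod_type_right]
  calc _ ≤ ∑ _m : Fin L, B ^ L := by
        refine Finset.sum_le_sum fun m _ => le_of_eq ?_
        have hm : (m : ℕ) + 1 ≤ L := m.2
        have hL : 0 < L := by omega
        have e : ∀ t : Fin (B ^ L), scaleValue B L (finProdFinEquiv (t, m)) =
            if B ^ ((m : ℕ) + 1) ∣ (t : ℕ) then B ^ ((m : ℕ) + 1) else 0 := by
          intro t
          simp only [scaleValue, finProdFinEquiv_apply_val, Nat.add_mul_mod_self_left,
            Nat.mod_eq_of_lt m.2, Nat.add_mul_div_left _ _ hL, Nat.div_eq_of_lt m.2, zero_add]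
        simp_rw [e]
        rw [Fin.sum_univ_eq_sum_range (fun t => if B ^ ((m : ℕ) + 1) ∣ t then B ^ ((m : ℕ) + 1)
          else 0), ← Finset.sum_filter, Finset.sum_const, smul_eq_mul, Finset.range_eq_Ico]
        have h := card_filter_dvd_Ico (pow_pos hB ((m : ℕ) + 1)) 0 (B ^ (L - ((m : ℕ) + 1)))
        rw [zero_add, ← pow_add, Nat.add_sub_cancel' hm] at h
        rw [h, ← pow_add, Nat.sub_add_cancel hm]
    _ = _ := by simp [mul_comm]

theorem mul_sum_pow_le {B : ℕ} (hB : 1 ≤ B) (l : ℕ) :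
    (B - 1) * ∑ m ∈ Finset.range l, B ^ (m + 1) ≤ B ^ (l + 1) := by
  obtain ⟨b, rfl⟩ := Nat.exists_eq_add_of_le' hB
  simp only [Nat.add_sub_cancel]
  induction l with
  | zero => simp
  | succ l ih =>
    rw [Finset.sum_range_succ, mul_add]
    calc _ ≤ (b + 1) ^ (l + 1) + b * (b + 1) ^ (l + 1) := by gcongr
      _ = _ := by ring

/-- After its first entry the window ends before scale `l` recurs, and larger scales are absent
because `B` does not divide `a`. A smaller scale `m` meets the window only among `D` consecutive
times, hence in at most `D / B ^ (m + 1)` nonzero entries, whose squares add up to at most `B ^ (m +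
1) * D`. The geometric sum over `m` is at most `D / (B - 1)`, and `B - 1 ≥ 512`. -/
theorem sum_scaleValue_sq_le {B L l a r : ℕ} (hB : 513 ≤ B) (hl : l < L) (ha : ¬ B ∣ a)
    (hr : r < B ^ (l + 1) * L) :
    512 * ∑ k ∈ Finset.Ioc (a * B ^ (l + 1) * L + l) (a * B ^ (l + 1) * L + l + r),
      scaleValue B L k ^ 2 ≤ (B ^ (l + 1)) ^ 2 := by
  classical
  set D := B ^ (l + 1) with hD
  have hB0 : 0 < B := by omega
  have hL : 0 < L := by omega
  have hDpos : 0 < D := pow_pos hB0 _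
  set S := Finset.Ioc (a * D * L + l) (a * D * L + l + r) with hS
  set g : ℕ × ℕ → ℕ := fun p => if B ^ (p.1 + 1) ∣ p.2 then (B ^ (p.1 + 1)) ^ 2 else 0 with hg
  have hgv : ∀ k, scaleValue B L k ^ 2 = g (k % L, k / L) := by
    intro k
    simp only [scaleValue, hg]
    split_ifs <;> simp
  have hsub : (S.filter fun k => scaleValue B L k ^ 2 ≠ 0).image (fun k => (k % L, k / L)) ⊆
      Finset.range l ×ˢ Finset.Ico (a * D + 1) (a * D + 1 + D) := by
    intro p hp
    obtain ⟨k, hk, rfl⟩ := Finset.mem_image.1 hp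
    obtain ⟨hkS, hkv⟩ := Finset.mem_filter.1 hk
    obtain ⟨hk1, hk2⟩ := Finset.mem_Ioc.1 hkS
    have hdvd : B ^ (k % L + 1) ∣ k / L := by
      by_contra h
      simp [scaleValue, h] at hkv
    have hkd := Nat.mod_add_div k L
    have hm := Nat.mod_lt k hL
    set m := k % L
    set t := k / L
    have hlow : a * D ≤ t := by
      by_contra! h
      have : L * (t + 1) ≤ L * (a * D) := Nat.mul_le_mul_left L h
      nlinarith
    have hhigh : t ≤ a * D + D := by
      by_contra! h
      have : L * (a * D + D + 1) ≤ L * t := Nat.mul_le_mul_left L h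
      nlinarith
    have hml : m < l := by
      by_contra! hml
      have ht : t < a * D + D := by
        by_contra! h
        have : L * (a * D + D) ≤ L * t := Nat.mul_le_mul_left L h
        nlinarith
      have hDt : D ∣ t := dvd_trans (pow_dvd_pow B (by omega)) hdvd
      obtain ⟨s, hs⟩ := hDt
      have has : s = a := by
        have h1 : D * a ≤ D * s := by rw [← hs]; linarith
        have h2 : D * s < D * (a + 1) := by rw [← hs]; linarith
        have h3 := le_of_mul_le_mul_left h1 hDpos
        have h4 := lt_of_mul_lt_mul_left h2 (Nat.zero_le D)
        omega
      rcases hml.eq_or_lt with h | h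
      · rw [hs, has] at hkd
        have : L * (D * a) = a * D * L := by ring
        omega
      · have hDB : D * B ∣ t := by
          rw [hD, ← pow_succ]
          exact dvd_trans (pow_dvd_pow B (by omega)) hdvd
        rw [hs, has] at hDB
        exact ha (Nat.dvd_of_mul_dvd_mul_left hDpos hDB)
    have hlow' : a * D < t := by
      rcases hlow.eq_or_lt with h | h
      · exfalso
        rw [← h] at hkd
        have : L * (a * D) = a * D * L := by ring
        omega
      · exact h
    simp only [Finset.mem_product, Finset.mem_range, Finset.mem_Ico]
    omega
  have hinj : Set.InjOn (fun k => (k % L, k / L)) (S.filter fun k => scaleValue B L k ^ 2 ≠ 0) := by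
    intro k _ k' _ h
    simp only [Prod.mk.injEq] at h
    rw [← Nat.mod_add_div k L, ← Nat.mod_add_div k' L, h.1, h.2]
  calc 512 * ∑ k ∈ S, scaleValue B L k ^ 2
      = 512 * ∑ k ∈ S.filter (fun k => scaleValue B L k ^ 2 ≠ 0), g (k % L, k / L) := by
        rw [← Finset.sum_filter_ne_zero]
        simp_rw [hgv]
    _ = 512 * ∑ p ∈ (S.filter fun k => scaleValue B L k ^ 2 ≠ 0).image
          (fun k => (k % L, k / L)), g p := by
        rw [Finset.sum_image hinj]
    _ ≤ 512 * ∑ p ∈ Finset.range l ×ˢ Finset.Ico (a * D + 1) (a * D + 1 + D), g p := by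
        gcongr
    _ = 512 * ∑ m ∈ Finset.range l, B ^ (m + 1) * D := by
        rw [Finset.sum_product]
        congr 1
        refine Finset.sum_congr rfl fun m hm => ?_
        have hm := Finset.mem_range.1 hm
        simp only [hg]
        rw [← Finset.sum_filter, Finset.sum_const, smul_eq_mul]
        have hDm : D = B ^ (m + 1) * B ^ (l - m) := by
          rw [hD, ← pow_add]
          congr 1
          omega
        have h := card_filter_dvd_Ico (pow_pos hB0 (m + 1)) (a * D + 1) (B ^ (l - m))
        rw [← hDm] at h
        rw [h, hDm]
        ring
    _ = 512 * (∑ m ∈ Finset.range l, B ^ (m + 1)) * D := by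
        rw [← Finset.sum_mul, mul_assoc]
    _ ≤ ((B - 1) * ∑ m ∈ Finset.range l, B ^ (m + 1)) * D := by
        gcongr
        omega
    _ ≤ D * D := by
        gcongr
        exact mul_sum_pow_le (by omega) l
    _ = _ := by ring

/-- The position of the entry of scale `l + 1` at the start of the `q`-th window. -/
def windowStart (B L l q : ℕ) : ℕ := (B * q + 1) * B ^ (l + 1) * L + l

/-- The window begins in time row `(B q + 1) D` and ends before row `(B q + 3) D`, and `B q + 3 ≤ B
q'`. -/
theorem windowStart_add_lt {B L l q q' r : ℕ} (hB : 3 ≤ B) (hl : l < L)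
    (hr : r < B ^ (l + 1) * L) (hq : q < q') :
    windowStart B L l q + r < B * q' * B ^ (l + 1) * L := by
  have hD : 0 < B ^ (l + 1) := pow_pos (by omega) _
  have h1 : B * q + 3 ≤ B * q' := by nlinarith
  have h2 : (B * q + 3) * (B ^ (l + 1) * L) ≤ B * q' * (B ^ (l + 1) * L) := by gcongr
  have h3 : L ≤ B ^ (l + 1) * L := Nat.le_mul_of_pos_left L hD
  unfold windowStart
  nlinarith

theorem windowStart_add_lt_length {B L l q r : ℕ} (hB : 3 ≤ B) (hl : l + 1 < L)
    (hr : r < B ^ (l + 1) * L) (hq : q < B ^ (L - l - 2)) :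
    windowStart B L l q + r < B ^ L * L := by
  refine (windowStart_add_lt hB (by omega) hr hq).trans_le (le_of_eq ?_)
  rw [← pow_succ', ← pow_add]
  congr 2
  omega

theorem windowStart_mod {B L l q : ℕ} (hl : l < L) : windowStart B L l q % L = l := by
  rw [windowStart, Nat.mul_add_mod_self_right, Nat.mod_eq_of_lt hl]

theorem scaleValue_windowStart {B L l q : ℕ} (hl : l < L) :
    scaleValue B L (windowStart B L l q) = B ^ (l + 1) := by
  rw [scaleValue, windowStart_mod hl, if_pos]
  have hL : 0 < L := by omega
  rw [windowStart, add_comm _ l, Nat.add_mul_div_right _ _ hL, Nat.div_eq_of_lt hl, zero_add]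
  exact Dvd.intro_left _ rfl

end ApproxCounting

/-! ### Summation over windows, offsets and scales. -/

namespace ApproxCounting

/-- Here `|Q| D = B ^ (L - 1)` while the count is at most `B ^ L * L`, whence the hypothesis on `ε`;
and `|Q| + 1 ≤ 2 B ^ (L - 1) ≤ B ^ L` matches the one on `δ`. Position `0` serves as `k₀`: it
carries a nonzero value, since every power of `B` divides `0`, and precedes all windows. -/
theorem StreamingAlgorithm.le_sum_corrProb_window (A : StreamingAlgorithm) {ε δ : ℝ} {B L l r : ℕ}
    (hA : A.IsApproxCounterUpTo ε δ (B ^ L * L)) (hB : 513 ≤ B) (hl : l + 1 < L)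
    (hr : r < B ^ (l + 1) * L) (hε : 0 ≤ ε) (hεL : ε * L * (8 * B) ≤ 1)
    (hδ : 8 ^ (B ^ L) * δ < 1) (hδ0 : 0 ≤ δ) (j i : ℕ → Fin (B ^ L * L))
    (hj : ∀ q < B ^ (L - l - 2), (j q : ℕ) = windowStart B L l q)
    (hi : ∀ q < B ^ (L - l - 2), (i q : ℕ) = windowStart B L l q + r) :
    3 / 64 * ((B ^ (L - l - 2) : ℕ) : ℝ≥0∞) ≤ ∑ q ∈ Finset.range (B ^ (L - l - 2)),
      A.corrProb (bitInput fun k : Fin (B ^ L * L) => scaleValue B L k) (i q) (j q) := by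
  have hB0 : 0 < B := by omega
  have hn : 0 < B ^ L * L := Nat.mul_pos (pow_pos hB0 _) (by omega)
  have hlL : l < L := by omega
  have hstart : ∀ q, 0 < windowStart B L l q := fun q => by
    have : 0 < (B * q + 1) * B ^ (l + 1) * L :=
      Nat.mul_pos (Nat.mul_pos (by omega) (pow_pos hB0 _)) (by omega)
    exact Nat.add_pos_left this l
  have hlt : ∀ q q', q < q' → windowStart B L l q + r < windowStart B L l q' := fun q q' h => by
    refine (windowStart_add_lt (by omega) hlL hr h).trans_le ?_
    rw [windowStart]
    refine le_trans ?_ (Nat.le_add_right _ _)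
    gcongr
    omega
  have hpow : B ^ (L - l - 2) * B ^ (l + 1) = B ^ (L - 1) := by
    rw [← pow_add]
    congr 1
    omega
  have hpowL : B ^ L = B * B ^ (L - 1) := by
    rw [← pow_succ']
    congr 1
    omega
  have key := A.le_sum_corrProb (fun k : Fin (B ^ L * L) => scaleValue B L k) hA
    (sum_scaleValue_le hB0 L) (Finset.range (B ^ (L - l - 2))) j i (D := B ^ (l + 1))
    (k₀ := ⟨0, hn⟩) ?_ ?_ (pow_pos hB0 _) ?_ ?_ ?_ ?_ hε ?_ ?_
  · rwa [Finset.card_range] at key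
  · intro q hq
    have hq := Finset.mem_range.1 hq
    rw [Fin.le_def, hj q hq, hi q hq]
    omega
  · intro q hq q' hq' hne
    have hq := Finset.mem_range.1 hq
    have hq' := Finset.mem_range.1 hq'
    rw [Fin.lt_def, Fin.lt_def, hj q hq, hj q' hq', hi q hq, hi q' hq']
    rcases lt_or_gt_of_ne hne with h | h
    · exact Or.inl (hlt _ _ h)
    · exact Or.inr (hlt _ _ h)
  · intro q hq
    rw [hj q (Finset.mem_range.1 hq), scaleValue_windowStart hlL]
  · intro q hq
    have hq := Finset.mem_range.1 hq
    have ha : ¬ B ∣ B * q + 1 := by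
      rw [Nat.dvd_add_right (Dvd.intro q rfl), Nat.dvd_one]
      omega
    refine le_trans ?_ (sum_scaleValue_sq_le hB hlL ha hr)
    gcongr
    rw [Finset.Icc_erase_left]
    refine le_of_eq ?_
    have hmap : (Finset.Ioc (j q) (i q)).map Fin.valEmbedding =
        Finset.Ioc (windowStart B L l q) (windowStart B L l q + r) := by
      rw [Fin.map_valEmbedding_Ioc, hj q hq, hi q hq]
    rw [windowStart] at hmap
    rw [← hmap, Finset.sum_map]
    rfl
  · intro q hq hmem
    have hq := Finset.mem_range.1 hq
    have h1 := Fin.le_def.1 (Finset.mem_Icc.1 hmem).1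
    rw [hj q hq] at h1
    have := hstart q
    simp only at h1
    omega
  · simp only [scaleValue, Nat.zero_div, dvd_zero, if_true]
    exact pow_pos hB0 _
  · rw [Finset.card_range]
    have e : ((B ^ (L - l - 2) : ℕ) : ℝ) * ((B ^ (l + 1) : ℕ) : ℝ) = (B : ℝ) ^ (L - 1) := by
      exact_mod_cast hpow
    rw [e]
    have hpos : (0 : ℝ) < (B : ℝ) ^ (L - 1) := by positivity
    push_cast
    have e2 : (B : ℝ) ^ L = B * (B : ℝ) ^ (L - 1) := by exact_mod_cast hpowL
    rw [e2]
    nlinarith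
  · rw [Finset.card_range]
    refine lt_of_le_of_lt (mul_le_mul_of_nonneg_right (pow_le_pow_right₀ (by norm_num) ?_) hδ0) hδ
    have h1 : 1 ≤ B ^ (L - l - 2) := Nat.one_le_pow _ _ hB0
    have h2 : B ^ (L - l - 2) ≤ B ^ (L - 1) := Nat.pow_le_pow_right hB0 (by omega)
    have h3 : 2 * B ^ (L - 1) ≤ B * B ^ (L - 1) := by gcongr; omega
    omega

/-- At each scale, `B ^ (l + 1) * L` offsets times `B ^ (L - l - 2)` windows give `L * B ^ (L - 1)`
pairs, independently of `l`. Pairs of different scales are distinct because `j % L` recovers `l`.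
The top scale is left out: its only nonzero entry sits at time `0`, a multiple of every power of
`B`. -/
theorem StreamingAlgorithm.le_sum_sum_corrProb (A : StreamingAlgorithm) {ε δ : ℝ} {B L : ℕ}
    (hA : A.IsApproxCounterUpTo ε δ (B ^ L * L)) (hB : 513 ≤ B) (hL : 1 ≤ L)
    (hε : 0 ≤ ε) (hεL : ε * L * (8 * B) ≤ 1)
    (hδ : 8 ^ (B ^ L) * δ < 1) (hδ0 : 0 ≤ δ) :
    3 / 64 * (((L - 1) * (L * B ^ (L - 1)) : ℕ) : ℝ≥0∞) ≤
      ∑ i, ∑ j ∈ Finset.Iic i,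
        A.corrProb (bitInput fun k : Fin (B ^ L * L) => scaleValue B L k) i j := by
  classical
  have hB0 : 0 < B := by omega
  have hn : 0 < B ^ L * L := Nat.mul_pos (pow_pos hB0 _) (by omega)
  set f := A.corrProb (bitInput fun k : Fin (B ^ L * L) => scaleValue B L k) with hf
  set P : Finset (Fin (B ^ L * L) × Fin (B ^ L * L)) := Finset.univ.filter fun p => p.2 ≤ p.1
    with hP
  have hsum : ∑ i, ∑ j ∈ Finset.Iic i, f i j = ∑ p ∈ P, f p.1 p.2 := by
    rw [hP, Finset.sum_filter, Fintype.sum_prod_type]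
    refine Finset.sum_congr rfl fun i _ => ?_
    rw [← Finset.sum_filter]
    refine Finset.sum_congr ?_ fun _ _ => rfl
    ext j
    simp
  rw [hsum]
  -- Reduction modulo the length only makes the index total; all indices used are in range.
  set toIdx : ℕ → Fin (B ^ L * L) := fun x => ⟨x % (B ^ L * L), Nat.mod_lt _ hn⟩ with htoIdx
  have hidx : ∀ x, x < B ^ L * L → (toIdx x : ℕ) = x := fun x hx => Nat.mod_eq_of_lt hx
  have hscale : ∀ l < L - 1, 3 / 64 * ((L * B ^ (L - 1) : ℕ) : ℝ≥0∞) ≤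
      ∑ p ∈ P.filter (fun p => (p.2 : ℕ) % L = l), f p.1 p.2 := by
    intro l hl
    have hlL : l + 1 < L := by omega
    have hbound : ∀ r < B ^ (l + 1) * L, ∀ q < B ^ (L - l - 2),
        windowStart B L l q + r < B ^ L * L := fun r hr q hq =>
      windowStart_add_lt_length (by omega) hlL hr hq
    have hbound0 : ∀ r < B ^ (l + 1) * L, ∀ q < B ^ (L - l - 2),
        windowStart B L l q < B ^ L * L := fun r hr q hq =>
      (Nat.le_add_right _ _).trans_lt (hbound r hr q hq)
    set W := Finset.range (B ^ (l + 1) * L) ×ˢ Finset.range (B ^ (L - l - 2)) with hW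
    set g : ℕ × ℕ → Fin (B ^ L * L) × Fin (B ^ L * L) := fun p =>
      (toIdx (windowStart B L l p.2 + p.1), toIdx (windowStart B L l p.2)) with hg
    have hgv : ∀ p ∈ W, ((g p).1 : ℕ) = windowStart B L l p.2 + p.1 ∧
        ((g p).2 : ℕ) = windowStart B L l p.2 := by
      intro p hp
      obtain ⟨h1, h2⟩ := Finset.mem_product.1 hp
      rw [Finset.mem_range] at h1 h2
      exact ⟨hidx _ (hbound _ h1 _ h2), hidx _ (hbound0 _ h1 _ h2)⟩
    have hinj : Set.InjOn g W := by
      intro p hp p' hp' h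
      obtain ⟨h1, h2⟩ := hgv p hp
      obtain ⟨h1', h2'⟩ := hgv p' hp'
      rw [h] at h1 h2
      have hs : windowStart B L l p.2 = windowStart B L l p'.2 := h2.symm.trans h2'
      have hr : p.1 = p'.1 := by omega
      have hq : p.2 = p'.2 := by
        unfold windowStart at hs
        have h3 := Nat.eq_of_mul_eq_mul_right (show 0 < L by omega) (Nat.add_right_cancel hs)
        have h4 := Nat.eq_of_mul_eq_mul_right (pow_pos hB0 (l + 1)) h3
        exact Nat.eq_of_mul_eq_mul_left hB0 (Nat.add_right_cancel h4)
      exact Prod.ext hr hq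
    calc 3 / 64 * ((L * B ^ (L - 1) : ℕ) : ℝ≥0∞)
        = ∑ _r ∈ Finset.range (B ^ (l + 1) * L), 3 / 64 * ((B ^ (L - l - 2) : ℕ) : ℝ≥0∞) := by
          rw [Finset.sum_const, Finset.card_range, nsmul_eq_mul, mul_left_comm, ← Nat.cast_mul]
          congr 2
          rw [mul_right_comm, ← pow_add, mul_comm]
          congr 2
          omega
      _ ≤ ∑ r ∈ Finset.range (B ^ (l + 1) * L), ∑ q ∈ Finset.range (B ^ (L - l - 2)),
            f (g (r, q)).1 (g (r, q)).2 := by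
          refine Finset.sum_le_sum fun r hr => ?_
          have hr := Finset.mem_range.1 hr
          exact A.le_sum_corrProb_window hA hB hlL hr hε hεL hδ hδ0 (fun q => (g (r, q)).2)
            (fun q => (g (r, q)).1) (fun q hq => hidx _ (hbound0 r hr q hq))
            (fun q hq => hidx _ (hbound r hr q hq))
      _ = ∑ p ∈ W.image g, f p.1 p.2 := by
          rw [Finset.sum_image hinj, hW, Finset.sum_product]
      _ ≤ _ := by
          refine Finset.sum_le_sum_of_subset fun p hp => ?_
          obtain ⟨w, hw, rfl⟩ := Finset.mem_image.1 hp
          obtain ⟨h1, h2⟩ := hgv w hw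
          simp only [hP, Finset.mem_filter, Finset.mem_univ, true_and, Fin.le_def, h1, h2]
          exact ⟨by omega, windowStart_mod (by omega)⟩
  calc 3 / 64 * (((L - 1) * (L * B ^ (L - 1)) : ℕ) : ℝ≥0∞)
      = ∑ _l ∈ Finset.range (L - 1), 3 / 64 * ((L * B ^ (L - 1) : ℕ) : ℝ≥0∞) := by
        rw [Finset.sum_const, Finset.card_range, nsmul_eq_mul, Nat.cast_mul (L - 1)]
        ring
    _ ≤ ∑ l ∈ Finset.range (L - 1), ∑ p ∈ P.filter (fun p => (p.2 : ℕ) % L = l), f p.1 p.2 :=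
        Finset.sum_le_sum fun l hl => hscale l (Finset.mem_range.1 hl)
    _ ≤ ∑ l ∈ Finset.range L, ∑ p ∈ P.filter (fun p => (p.2 : ℕ) % L = l), f p.1 p.2 :=
        Finset.sum_le_sum_of_subset (Finset.range_subset_range.2 (by omega))
    _ = _ := Finset.sum_fiberwise_of_maps_to
        (fun p _ => Finset.mem_range.2 (Nat.mod_lt _ (by omega))) _

end ApproxCounting

/-! ### Conclusion and choice of constants. -/

namespace ApproxCounting

theorem interleavedDist_sum_le {B : ℕ} (hB : 0 < B) (L : ℕ) :
    (interleavedDist B L).toMeasure {x | ∑ i, x i ≤ B ^ L * L} = 1 := by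
  rw [PMF.toMeasure_apply_eq_one_iff _ MeasurableSet.of_discrete, interleavedDist_eq_map]
  intro x hx
  obtain ⟨b, -, rfl⟩ := (PMF.mem_support_map_iff _ _ _).1 hx
  refine le_trans (Finset.sum_le_sum fun k _ => ?_) (sum_scaleValue_le hB L)
  simp only [bitInput]
  split_ifs <;> simp

theorem exists_isGreatest_pow_lt {b y : ℝ} (hb : 1 < b) (hy : 1 < y) :
    ∃ L : ℕ, IsGreatest {k : ℕ | b ^ k < y} L ∧ y ≤ b ^ (L + 1) := by
  classical
  have hex : ∃ k : ℕ, y ≤ b ^ k := by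
    obtain ⟨k, hk⟩ := pow_unbounded_of_one_lt y hb
    exact ⟨k, hk.le⟩
  have h0 : Nat.find hex ≠ 0 := by
    intro h
    have := Nat.find_spec hex
    rw [h, pow_zero] at this
    linarith
  obtain ⟨L, hL⟩ := Nat.exists_eq_succ_of_ne_zero h0
  have hspec := Nat.find_spec hex
  rw [hL] at hspec
  refine ⟨L, ⟨not_le.1 (Nat.find_min hex (by omega)), fun k hk => ?_⟩, hspec⟩
  by_contra! h
  have h1 : b ^ (L + 1) ≤ b ^ k := pow_le_pow_right₀ hb.le h
  exact absurd (hspec.trans h1) (not_le.2 hk)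

/-- The constant is `(3/64) / 30 = 1/640`, halved by `L - 1 ≥ L / 2`; the `B` comes from `B ^ (L -
1) = B ^ L / B`. -/
theorem StreamingAlgorithm.le_infoCost_and_avgMemory (A : StreamingAlgorithm) {ε δ : ℝ} {B L : ℕ}
    (hA : A.IsApproxCounterUpTo ε δ (B ^ L * L)) (hB : 513 ≤ B) (hL : 2 ≤ L)
    (hε : 0 ≤ ε) (hεL : ε * L * (8 * B) ≤ 1)
    (hδ : 8 ^ (B ^ L) * δ < 1) (hδ0 : 0 ≤ δ) :
    ENNReal.ofReal (((B ^ L * L : ℕ) : ℝ) * (L / (1280 * B))) ≤ A.infoCost (interleavedDist B L) ∧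
    ENNReal.ofReal (L / (1280 * B)) ≤ ENNReal.ofReal (Real.log 4) *
      A.avgMemory (interleavedDist B L) + ENNReal.ofReal (Real.log 2) := by
  have hB0 : 0 < B := by omega
  have hBr : (0 : ℝ) < B := by exact_mod_cast hB0
  have hn : B ^ L * L ≠ 0 := (Nat.mul_pos (pow_pos hB0 _) (by omega)).ne'
  have hsum : ENNReal.ofReal (((B ^ L * L : ℕ) : ℝ) * (L / (1280 * B))) ≤
      ∑ i, ∑ j ∈ Finset.Iic i,
        A.corrProb (bitInput fun k : Fin (B ^ L * L) => scaleValue B L k) i j / 30 := by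
    simp_rw [div_eq_mul_inv _ (30 : ℝ≥0∞), ← Finset.sum_mul]
    refine le_trans ?_ (mul_le_mul_left
      (A.le_sum_sum_corrProb hA hB (by omega) hε hεL hδ hδ0) 30⁻¹)
    have e : (3 / 64 * (((L - 1) * (L * B ^ (L - 1)) : ℕ) : ℝ≥0∞)) * 30⁻¹ =
        ENNReal.ofReal (3 / 64 * (((L - 1) * (L * B ^ (L - 1)) : ℕ) : ℝ) * 30⁻¹) := by
      rw [ENNReal.ofReal_mul (by positivity), ENNReal.ofReal_mul (by positivity),
        ENNReal.ofReal_natCast, ENNReal.ofReal_div_of_pos (by norm_num),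
        ENNReal.ofReal_inv_of_pos (by norm_num)]
      simp
    rw [e]
    refine ENNReal.ofReal_le_ofReal ?_
    have hL1 : ((L - 1 : ℕ) : ℝ) = L - 1 := by
      rw [Nat.cast_sub (by omega), Nat.cast_one]
    have hpow : (B : ℝ) ^ L = B * (B : ℝ) ^ (L - 1) := by
      rw [← pow_succ']
      congr 1
      omega
    have hL2 : (2 : ℝ) ≤ L := by exact_mod_cast hL
    push_cast
    rw [hL1, hpow]
    have hp : (0 : ℝ) < (B : ℝ) ^ (L - 1) := by positivity
    have e1 : (B : ℝ) * (B : ℝ) ^ (L - 1) * L * (L / (1280 * B)) =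
        (L * (B : ℝ) ^ (L - 1)) * (L / 1280) := by field_simp
    have e2 : 3 / 64 * (((L : ℝ) - 1) * (L * (B : ℝ) ^ (L - 1))) * 30⁻¹ =
        (L * (B : ℝ) ^ (L - 1)) * ((L - 1) / 640) := by ring
    rw [e1, e2]
    exact mul_le_mul_of_nonneg_left (by linarith) (by positivity)
  refine ⟨hsum.trans (A.sum_corrProb_le_infoCost _ _ (interleavedDist_eq_map B L)), ?_⟩
  refine le_trans ?_ (A.sum_corrProb_le_avgMemory _ hn _ (interleavedDist_eq_map B L))
  have hn0 : ((B ^ L * L : ℕ) : ℝ≥0∞) ≠ 0 := by exact_mod_cast hn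
  rw [ENNReal.le_div_iff_mul_le (Or.inl hn0) (Or.inl (ENNReal.natCast_ne_top _))]
  refine le_trans (le_of_eq ?_) hsum
  rw [mul_comm, ENNReal.ofReal_mul (by positivity), ENNReal.ofReal_natCast]

end ApproxCounting

theorem mainTheorem2 :
    ∃ B : ℕ, 2 ≤ B ∧
    ∃ c₁ c₂ c₃ c₄ c₅ c₆ c₇ : ℝ,
      0 < c₁ ∧ 0 < c₂ ∧ 0 < c₃ ∧ 0 < c₄ ∧ 0 < c₅ ∧ 0 < c₆ ∧ 0 < c₇ ∧
      ∀ δ : ℝ, 0 < δ → δ < c₁ →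
        ∃ L n : ℕ,
          1 ≤ L ∧ n = B ^ L * L ∧
          IsGreatest {k : ℕ | (B : ℝ) ^ k < Real.logb 32 (1 / δ)} L ∧
          c₃ * Real.log (1 / δ) ^ c₄ ≤ (n : ℝ) ∧
          (ApproxCounting.interleavedDist B L).toMeasure {x | ∑ i, x i ≤ n} = 1 ∧
          c₇ * Real.log (Real.log (1 / δ)) ≤
            min (Real.log (n : ℝ)) (Real.log (Real.log (1 / δ))) ∧
          ∀ ε : ℝ, 0 < ε → ε < c₂ / Real.log (Real.log (1 / δ)) →
            ∀ A : ApproxCounting.StreamingAlgorithm, A.IsApproxCounterUpTo ε δ n →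
              ENNReal.ofReal (c₅ * (n : ℝ) * Real.log (Real.log (1 / δ))) ≤
                  A.infoCost (ApproxCounting.interleavedDist B L) ∧
              ENNReal.ofReal (c₆ * Real.log (Real.log (1 / δ))) ≤
                  A.avgMemory (ApproxCounting.interleavedDist B L) ∧
              ENNReal.ofReal
                  (c₆ * min (Real.log (n : ℝ)) (Real.log (Real.log (1 / δ)))) ≤
                  A.avgMemory (ApproxCounting.interleavedDist B L) := by
  -- The least base with `B - 1 ≥ 512`, as the variance bound needs.
  obtain ⟨B, hB⟩ : ∃ B : ℕ, B = 513 := ⟨513, rfl⟩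
  -- For `L ≥ L₀`, `L / (2560 B) ≥ 1 ≥ log 2`, so half of the entropy bound absorbs the additive
  -- `log 2`.
  obtain ⟨L₀, hL₀⟩ : ∃ L₀ : ℕ, 2560 * B ≤ L₀ := ⟨2560 * B, le_rfl⟩
  have hBr : (B : ℝ) = 513 := by rw [hB]; norm_num
  have hB1 : (1 : ℝ) < B := by rw [hBr]; norm_num
  have hB0 : (0 : ℝ) < B := by linarith
  set K := Real.log B with hK
  have hKpos : 0 < K := Real.log_pos hB1
  have hl32 : 1 ≤ Real.log 32 := by
    rw [Real.le_log_iff_exp_le (by norm_num)]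
    exact Real.exp_one_lt_d9.le.trans (by norm_num)
  have hl4 : 0 < Real.log 4 := Real.log_pos (by norm_num)
  have hl2 : Real.log 2 ≤ 1 := by
    have := Real.log_two_lt_d9
    linarith
  have hl32K : Real.log 32 ≤ B := by
    have := Real.log_le_sub_one_of_pos (show (0 : ℝ) < 32 by norm_num)
    rw [hBr]
    linarith
  -- `c₁` forces `L ≥ L₀`. The others come from `L K ≤ log log (1 / δ) ≤ 3 K L`: the lower bound
  -- turns the condition with `c₂` into `ε * L * (8 * B) ≤ 1`, and the upper one accounts for the
  -- factor 3 in `c₅`, `c₆` and `c₇`.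
  refine ⟨B, by omega, ((32 : ℝ) ^ (B ^ L₀))⁻¹, K / (8 * B), 1 / (B * Real.log 32), 1,
    1 / (3 * K * (1280 * B)), 1 / (3 * K * (2560 * B) * Real.log 4), 1 / 3, by positivity,
    by positivity, by positivity, by norm_num, by positivity, by positivity, by norm_num, ?_⟩
  intro δ hδ0 hδ
  set x := 1 / δ with hx
  have hxpos : 0 < x := by positivity
  have hxgt : (32 : ℝ) ^ (B ^ L₀) < x := by
    rw [hx, one_div, lt_inv_comm₀ (by positivity) hδ0]
    exact hδ
  set y := Real.logb 32 x with hy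
  have hyx : Real.log x = y * Real.log 32 := by
    rw [hy, Real.logb, div_mul_cancel₀ _ (by linarith)]
  have hyL₀ : (B : ℝ) ^ L₀ < y := by
    rw [hy, Real.lt_logb_iff_rpow_lt (by norm_num) hxpos]
    have : (B : ℝ) ^ L₀ = ((B ^ L₀ : ℕ) : ℝ) := by push_cast; rfl
    rw [this, Real.rpow_natCast]
    exact hxgt
  have hy1 : 1 < y := (one_le_pow₀ hB1.le).trans_lt hyL₀
  obtain ⟨L, hL, hyL⟩ := ApproxCounting.exists_isGreatest_pow_lt hB1 hy1
  have hLL₀ : L₀ ≤ L := hL.2 hyL₀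
  have hL2 : 2 ≤ L := by omega
  have hLr : (2560 : ℝ) * B ≤ L := by exact_mod_cast hL₀.trans hLL₀
  have hLpos : (0 : ℝ) < L := by exact_mod_cast (show 0 < L by omega)
  have hLy : (B : ℝ) ^ L < y := hL.1
  have hlogx : (B : ℝ) ^ L < Real.log x := by
    rw [hyx]
    nlinarith
  have hBL : (0 : ℝ) < (B : ℝ) ^ L := by positivity
  set LL := Real.log (Real.log x) with hLL
  have hLLge : L * K ≤ LL := by
    rw [hLL, hK, ← Real.log_pow]
    exact Real.log_le_log hBL hlogx.le
  have hLLle : LL ≤ 3 * K * L := by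
    -- One factor `B` comes from maximality of `L`, the other from `log 32 ≤ B`.
    have h1 : Real.log x ≤ (B : ℝ) ^ (L + 2) := by
      rw [hyx, pow_succ _ (L + 1)]
      gcongr
    have h2 : LL ≤ (L + 2 : ℕ) * K := by
      rw [hLL, hK, ← Real.log_pow]
      exact Real.log_le_log (hBL.trans hlogx) h1
    push_cast at h2
    have h3 : (2 : ℝ) ≤ L := by exact_mod_cast hL2
    nlinarith
  have hLLpos : 0 < LL := lt_of_lt_of_le (by positivity) hLLge
  have hnr : ((B ^ L * L : ℕ) : ℝ) = (B : ℝ) ^ L * L := by push_cast; rfl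
  have hnge : (B : ℝ) ^ L ≤ ((B ^ L * L : ℕ) : ℝ) := by
    rw [hnr]
    have : (1 : ℝ) ≤ L := by exact_mod_cast (show 1 ≤ L by omega)
    nlinarith
  have hlogn : L * K ≤ Real.log ((B ^ L * L : ℕ) : ℝ) := by
    rw [hK, ← Real.log_pow]
    exact Real.log_le_log hBL hnge
  refine ⟨L, B ^ L * L, by omega, rfl, hL, ?_,
    ApproxCounting.interleavedDist_sum_le (by omega) L, ?_, ?_⟩
  · rw [Real.rpow_one]
    refine le_trans ?_ hnge
    rw [hyx, one_div, mul_comm, ← div_eq_mul_inv, div_le_iff₀ (by positivity)]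
    rw [pow_succ] at hyL
    calc y * Real.log 32 ≤ (B : ℝ) ^ L * B * Real.log 32 := by gcongr
      _ = _ := by ring
  · refine le_min ?_ ?_ <;> linarith
  intro ε hε hεlt A hA
  have hεL : ε * L * (8 * B) ≤ 1 := by
    rw [lt_div_iff₀ hLLpos, lt_div_iff₀ (by positivity)] at hεlt
    have h1 : ε * (L * K) * (8 * B) ≤ ε * LL * (8 * B) := by gcongr
    have h2 : (ε * L * (8 * B)) * K ≤ 1 * K := by linarith
    exact le_of_mul_le_mul_right h2 hKpos
  have hδ8 : (8 : ℝ) ^ (B ^ L) * δ < 1 := by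
    have h1 : (32 : ℝ) ^ (B ^ L) < x := by
      have h2 := hLy
      rw [hy, Real.lt_logb_iff_rpow_lt (by norm_num) hxpos] at h2
      have : (B : ℝ) ^ L = ((B ^ L : ℕ) : ℝ) := by push_cast; rfl
      rwa [this, Real.rpow_natCast] at h2
    have h2 : (8 : ℝ) ^ (B ^ L) ≤ 32 ^ (B ^ L) := by gcongr; norm_num
    rw [← lt_div_iff₀ hδ0]
    exact h2.trans_lt h1
  obtain ⟨hI, hM⟩ := A.le_infoCost_and_avgMemory hA (by omega) hL2 hε.le hεL hδ8 hδ0.le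
  have hmem : ENNReal.ofReal (1 / (3 * K * (2560 * B) * Real.log 4) * LL) ≤
      A.avgMemory (ApproxCounting.interleavedDist B L) := by
    have h1 : ENNReal.ofReal (L / (2560 * B)) + ENNReal.ofReal (Real.log 2) ≤
        ENNReal.ofReal (L / (1280 * B)) := by
      rw [← ENNReal.ofReal_add (by positivity) (Real.log_nonneg (by norm_num))]
      refine ENNReal.ofReal_le_ofReal ?_
      have h2 : 1 ≤ (L : ℝ) / (2560 * B) := by
        rw [le_div_iff₀ (by positivity)]
        linarith
      have h3 : (L : ℝ) / (1280 * B) = L / (2560 * B) + L / (2560 * B) := by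
        field_simp
        norm_num
      linarith
    have h4 := (ENNReal.add_le_add_iff_right ENNReal.ofReal_ne_top).1 (h1.trans hM)
    have h5 : (1 / (3 * K * (2560 * B) * Real.log 4) * LL) ≤ L / (2560 * B) / Real.log 4 := by
      rw [div_div, div_mul_eq_mul_div, one_mul, div_le_div_iff₀ (by positivity) (by positivity)]
      have : 0 ≤ (2560 * B) * Real.log 4 := by positivity
      calc LL * (2560 * B * Real.log 4) ≤ 3 * K * L * (2560 * B * Real.log 4) := by gcongr
        _ = _ := by ring
    refine (ENNReal.ofReal_le_ofReal h5).trans ?_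
    rw [ENNReal.ofReal_div_of_pos hl4]
    exact ENNReal.div_le_of_le_mul (by rw [mul_comm (A.avgMemory _)]; exact h4)
  refine ⟨le_trans (ENNReal.ofReal_le_ofReal ?_) hI, hmem,
    le_trans (ENNReal.ofReal_le_ofReal ?_) hmem⟩
  · have h1 : 1 / (3 * K * (1280 * B)) * LL ≤ L / (1280 * B) := by
      rw [div_mul_eq_mul_div, one_mul, div_le_div_iff₀ (by positivity) (by positivity)]
      calc LL * (1280 * B) ≤ 3 * K * L * (1280 * B) := by gcongr
        _ = _ := by ring
    calc _ = ((B ^ L * L : ℕ) : ℝ) * (1 / (3 * K * (1280 * B)) * LL) := by ring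
      _ ≤ _ := by gcongr
  · exact mul_le_mul_of_nonneg_left (min_le_right _ _) (by positivity)
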